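/- Let $w\in[0,1]$, put $\nu=\frac12\,\frac{5+3w}{1+3w}$ (so $\nu\in[1,\tfrac52]$), and let $T^3=\mathbb R^3/L$ be a flat torus, $L$ a lattice of rank three in $\mathbb R^3$, with the Laplacian $\Delta=\partial_1^2+\partial_2^2+\partial_3^2$ in Cartesian coordinates. Let $\Phi(\eta,x)$ be a smooth real-valued solution of $$\Phi''+\frac{6(1+w)}{1+3w}\,\frac1\eta\,\Phi'=w\,\Delta\Phi\qquad\text{on }(0,\infty)\times T^3,\qquad {}'=\frac{\partial}{\partial\eta}.$$ Then there are a strictly increasing sequence of real numbers $k_0<k_1<k_2<\cdots$ tending to infinity, with $k_n\ge-2\nu$ for all $n$, and smooth functions $\Phi_{k,l}$ on $T^3$ ($k\in\mathbb R$, $l\in\{0,1\}$) with $\Phi_{k,l}=0$ if $k$ is not a member of the sequence, such that the formal series $\sum_k(\Phi_{k,0}+\Phi_{k,1}\log\eta)\eta^k$ is asymptotic to $\Phi$ as $\eta\to0$, uniformly together with all spatial derivatives. That is, for every $N$ and every spatial derivative $\partial^\alpha$ (including the one of order zero), $$\sup_{x\in T^3}\Big|\partial^\alpha\Big(\Phi(\eta,\cdot)-\sum_{n\le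 N}(\Phi_{k_n,0}+\Phi_{k_n,1}\log\eta)\,\eta^{k_n}\Big)(x)\Big|=o(\eta^{k_N})\qquad(\eta\to0).$$ Moreover: 1. Every $\Phi_{k,l}$ is a finite linear combination of $\Phi_{-2\nu,0}$, $\Phi_{0,0}$ and their spatial derivatives, with constants that depend only on $w$, $k$ and $l$ (not on $L$ or on the solution $\Phi$). 2. If $\nu$ is not an integer, then $\Phi_{k,1}=0$ for all $k$. For every $w$, $\Phi_{k,1}=0$ for all $k<0$. 3. $\Phi_{k,0}$ can be non-zero only if $k=-2\nu+2i$ or $k=2i$ for an integer $i\ge0$, and $\Phi_{k,1}$ can be non-zero only if $k=2i$ for an integer $i\ge0$. 4. For all $k$, $$k(k+2\nu)\,\Phi_{k,0}=w\,\Delta\Phi_{k-2,0}-(2k+2\nu)\,\Phi_{k,1},\qquad k(k+2\nu)\,\Phi_{k,1}=w\,\Delta\Phi_{k-2,1}.$$ -/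

import Mathlib

open scoped ContDiff Laplacian

noncomputable section

/-- Euclidean three-space. -/
abbrev E3 : Type := EuclideanSpace ℝ (Fin 3)

/-- Functions on the flat torus `E3 / L` are the functions on `E3` that are periodic with respect
to the lattice `L`. -/
def LatticePeriodic (L : Submodule ℤ E3) (f : E3 → ℝ) : Prop :=
  ∀ v ∈ L, ∀ x, f (x + v) = f x

/-- The first order partial derivative in the `i`-th Cartesian coordinate. -/
def partialDeriv (i : Fin 3) (f : E3 → ℝ) : E3 → ℝ :=
  fun x => fderiv ℝ f x (EuclideanSpace.single i 1)

/-- The spatial derivative `∂_{i₁} ⋯ ∂_{iₘ} f` for the word `[i₁, …, iₘ]`; the empty word gives `f`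
itself. -/
def spatialDeriv (α : List (Fin 3)) (f : E3 → ℝ) : E3 → ℝ :=
  α.foldr partialDeriv f

/-- The constant coefficient differential operator `∑ α, P α • ∂_α` (a finite sum). -/
def constCoeffOp (P : List (Fin 3) →₀ ℝ) (f : E3 → ℝ) : E3 → ℝ :=
  fun x => P.sum fun α a => a * spatialDeriv α f x

/-- `Φ`, with arguments `η` and `x`, is a smooth solution of
`Φ'' + 6 (1 + w) / (1 + 3 w) η⁻¹ Φ' = w Δ Φ` on `(0, ∞) × E3 / L`, where `Δ` is the Laplacian of the
flat metric. The values of `Φ` for `η ≤ 0` play no role. -/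
structure IsSmoothSolution (w : ℝ) (L : Submodule ℤ E3) (Φ : ℝ → E3 → ℝ) : Prop where
  smooth : ContDiffOn ℝ ∞ (fun p : ℝ × E3 => Φ p.1 p.2) (Set.Ioi 0 ×ˢ Set.univ)
  periodic : ∀ η, 0 < η → LatticePeriodic L (Φ η)
  equation : ∀ η, 0 < η → ∀ x,
    deriv (deriv fun s => Φ s x) η
        + 6 * (1 + w) / (1 + 3 * w) * η⁻¹ * deriv (fun s => Φ s x) η
      = w * Δ (Φ η) x

/-- The number `ν = (5 + 3 w) / (2 (1 + 3 w))`. -/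
def nu (w : ℝ) : ℝ := 1 / 2 * ((5 + 3 * w) / (1 + 3 * w))

/-- The partial sum `∑_{n ≤ N} (c_{k,0} + c_{k,1} log η) η ^ k` with `k = κ n`. -/
def partialSum (κ : ℕ → ℝ) (c : ℝ → Fin 2 → E3 → ℝ) (N : ℕ) (η : ℝ) (x : E3) : ℝ :=
  ∑ n ∈ Finset.range (N + 1), (c (κ n) 0 x + c (κ n) 1 x * Real.log η) * η ^ κ n

/-- The formal series `∑_k (c_{k,0} + c_{k,1} log η) η ^ k`, where `k` runs through the sequence
`κ`, is asymptotic to `Φ` as `η → 0`: every spatial derivative of the remainder after the term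
with exponent `κ N` is `o(η ^ κ N)`, uniformly in space. -/
def IsAsymptoticTo (κ : ℕ → ℝ) (c : ℝ → Fin 2 → E3 → ℝ) (Φ : ℝ → E3 → ℝ) : Prop :=
  ∀ (N : ℕ) (α : List (Fin 3)) (ε : ℝ), 0 < ε → ∃ δ > 0, ∀ η, 0 < η → η < δ → ∀ x,
    |spatialDeriv α (fun y => Φ η y - partialSum κ c N η y) x| ≤ ε * η ^ κ N

end

/-! ### Directional derivatives of smooth functions. -/

section Directional

variable {E : Type*} [NormedAddCommGroup E] [NormedSpace ℝ E]

/-! In logarithmic time `τ = log η` the equation becomes `u'' + 2νu' = w e^{2τ} Δu`, whose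
right-hand side is a small perturbation as `τ → -∞`. The unperturbed modes are `e^{-2ντ}` and `1`;
their coefficients are the data `B` and `A`.

A rough a priori bound comes first. The space average of `e^{4ντ}(u'² + w e^{2τ}|∇u|²)` is
nondecreasing in `τ`, so `u'` is `O(e^{-2ντ})` in mean (`boxAvg_sq_timeDeriv_le`). The coefficients
do not depend on `x`, so all spatial derivatives obey the same bound, and a Sobolev inequality makes
it uniform (`decay_of_solvesWave`).

The bound is then bootstrapped. Since `(e^{2ντ}u')' = w e^{(2ν+2)τ} Δu`, a bound with exponent `σ`
feeds back with exponent `σ + 2`, as long as integration from `-∞` is possible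
(`SolvesWave.decay_timeDeriv`). The limit of `e^{2ντ}u'` yields `B`; after subtracting enough of the
formal solution generated by `B`, the limit of the rest is `A`. Subtracting long partial sums of
both formal solutions leaves a remainder that the same gain makes as small as desired
(`decay_remainder`).

The formal solutions are explicit: scalars times `Δ^j B` at exponent `-2ν + 2j`, and times `Δ^j A`
at `2j`. The recursion for the first divides by `2j(2j - 2ν)`, which vanishes only if `ν = j` is an
integer, hence at exponent `0`; there a logarithm appears and is inherited by later terms. The
remaining work merges the two ladders of exponents into one sequence (`exists_exponents`,
`decay_sub_partialSum`). -/

theorem contDiff_fderiv_apply {f : E → ℝ} (hf : ContDiff ℝ ∞ f) (v : E) :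
    ContDiff ℝ ∞ fun x => fderiv ℝ f x v :=
  (hf.fderiv_right (m := ∞) (by simp)).clm_apply contDiff_const

theorem fderiv_fderiv_apply_comm {f : E → ℝ} (hf : ContDiff ℝ ∞ f) (u v x : E) :
    fderiv ℝ (fun y => fderiv ℝ f y u) x v = fderiv ℝ (fun y => fderiv ℝ f y v) x u := by
  have hd : DifferentiableAt ℝ (fderiv ℝ f) x :=
    (hf.fderiv_right (m := ∞) (by simp)).differentiable (by simp) x
  have h : ∀ a : E, fderiv ℝ (fun y => fderiv ℝ f y a) x = (fderiv ℝ (fderiv ℝ f) x).flip a := by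
    intro a
    have := fderiv_clm_apply hd (differentiableAt_const a)
    rw [this]
    ext z
    simp
  have hs : IsSymmSndFDerivAt ℝ f x :=
    hf.contDiffAt.isSymmSndFDerivAt (by
      rw [minSmoothness_of_isRCLikeNormedField]
      exact WithTop.coe_le_coe.2 (le_top (a := (2 : ℕ∞))))
  rw [h, h]
  exact hs v u

end Directional

/-! ### Spatial derivatives and the Laplacian in coordinates. -/

section Spatial

variable {f g : E3 → ℝ}

theorem partialDeriv_smooth (hf : ContDiff ℝ ∞ f) (i : Fin 3) : ContDiff ℝ ∞ (partialDeriv i f) :=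
  contDiff_fderiv_apply hf _

theorem partialDeriv_add (hf : ContDiff ℝ ∞ f) (hg : ContDiff ℝ ∞ g) (i : Fin 3) :
    partialDeriv i (fun x => f x + g x) = fun x => partialDeriv i f x + partialDeriv i g x := by
  funext x
  simp only [partialDeriv]
  rw [fderiv_fun_add (hf.differentiable (by simp) x) (hg.differentiable (by simp) x)]
  rfl

theorem partialDeriv_const_mul (hf : ContDiff ℝ ∞ f) (a : ℝ) (i : Fin 3) :
    partialDeriv i (fun x => a * f x) = fun x => a * partialDeriv i f x := by
  funext x
  simp only [partialDeriv]
  rw [fderiv_const_mul (hf.differentiable (by simp) x)]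
  rfl

theorem partialDeriv_mul (hf : ContDiff ℝ ∞ f) (hg : ContDiff ℝ ∞ g) (i : Fin 3) (x : E3) :
    partialDeriv i (fun x => f x * g x) x
      = f x * partialDeriv i g x + partialDeriv i f x * g x := by
  simp only [partialDeriv]
  rw [fderiv_fun_mul (hf.differentiable (by simp) x) (hg.differentiable (by simp) x)]
  simp only [_root_.add_apply, _root_.smul_apply, smul_eq_mul]
  ring

theorem partialDeriv_comm (hf : ContDiff ℝ ∞ f) (i j : Fin 3) :
    partialDeriv i (partialDeriv j f) = partialDeriv j (partialDeriv i f) := by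
  funext x
  exact fderiv_fderiv_apply_comm hf _ _ x

theorem partialDeriv_periodic {L : Submodule ℤ E3} (hf : LatticePeriodic L f) (i : Fin 3) :
    LatticePeriodic L (partialDeriv i f) := by
  intro v hv x
  have h : (fun y => f (y + v)) = f := funext fun y => hf v hv y
  simp only [partialDeriv]
  rw [← fderiv_comp_add_right, h]

theorem spatialDeriv_nil (f : E3 → ℝ) : spatialDeriv [] f = f := rfl

theorem spatialDeriv_cons (i : Fin 3) (α : List (Fin 3)) (f : E3 → ℝ) :
    spatialDeriv (i :: α) f = partialDeriv i (spatialDeriv α f) := rfl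

theorem spatialDeriv_append (α β : List (Fin 3)) (f : E3 → ℝ) :
    spatialDeriv (α ++ β) f = spatialDeriv α (spatialDeriv β f) := by
  simp [spatialDeriv, List.foldr_append]

theorem spatialDeriv_smooth (hf : ContDiff ℝ ∞ f) (α : List (Fin 3)) :
    ContDiff ℝ ∞ (spatialDeriv α f) := by
  induction α with
  | nil => exact hf
  | cons i α ih => exact partialDeriv_smooth ih i

theorem spatialDeriv_periodic {L : Submodule ℤ E3} (hf : LatticePeriodic L f)
    (α : List (Fin 3)) : LatticePeriodic L (spatialDeriv α f) := by
  induction α with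
  | nil => exact hf
  | cons i α ih => exact partialDeriv_periodic ih i

theorem spatialDeriv_add (hf : ContDiff ℝ ∞ f) (hg : ContDiff ℝ ∞ g) (α : List (Fin 3)) :
    spatialDeriv α (fun x => f x + g x) = fun x => spatialDeriv α f x + spatialDeriv α g x := by
  induction α with
  | nil => rfl
  | cons i α ih =>
    rw [spatialDeriv_cons, ih, partialDeriv_add (spatialDeriv_smooth hf α)
      (spatialDeriv_smooth hg α)]
    rfl

theorem spatialDeriv_const_mul (hf : ContDiff ℝ ∞ f) (a : ℝ) (α : List (Fin 3)) :
    spatialDeriv α (fun x => a * f x) = fun x => a * spatialDeriv α f x := by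
  induction α with
  | nil => rfl
  | cons i α ih =>
    rw [spatialDeriv_cons, ih, partialDeriv_const_mul (spatialDeriv_smooth hf α)]
    rfl

theorem spatialDeriv_sub (hf : ContDiff ℝ ∞ f) (hg : ContDiff ℝ ∞ g) (α : List (Fin 3)) :
    spatialDeriv α (fun x => f x - g x) = fun x => spatialDeriv α f x - spatialDeriv α g x := by
  have h : (fun x => f x - g x) = fun x => f x + (-1) * g x := by funext x; ring
  rw [h, spatialDeriv_add hf (contDiff_const.mul hg), spatialDeriv_const_mul hg]
  funext x; ring

theorem spatialDeriv_zero (α : List (Fin 3)) : spatialDeriv α (fun _ => 0) = fun _ => 0 := by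
  have := spatialDeriv_const_mul (f := fun _ => 0) contDiff_const 0 α
  simpa using this

theorem spatialDeriv_sum {ι : Type*} (s : Finset ι) {f : ι → E3 → ℝ}
    (hf : ∀ j, ContDiff ℝ ∞ (f j)) (α : List (Fin 3)) :
    spatialDeriv α (fun x => ∑ j ∈ s, f j x) = fun x => ∑ j ∈ s, spatialDeriv α (f j) x := by
  classical
  induction s using Finset.induction_on with
  | empty => simpa using spatialDeriv_zero α
  | insert j s hj ih =>
    simp only [Finset.sum_insert hj]
    rw [spatialDeriv_add (hf j) (ContDiff.sum fun i _ => hf i), ih]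

theorem spatialDeriv_partialDeriv_comm (hf : ContDiff ℝ ∞ f) (i : Fin 3) (α : List (Fin 3)) :
    spatialDeriv α (partialDeriv i f) = partialDeriv i (spatialDeriv α f) := by
  induction α with
  | nil => rfl
  | cons j α ih =>
    rw [spatialDeriv_cons, ih, spatialDeriv_cons, partialDeriv_comm (spatialDeriv_smooth hf α)]

/-- The Laplacian as a sum of iterated partial derivatives. -/
noncomputable def lap (f : E3 → ℝ) : E3 → ℝ := fun x => ∑ i, partialDeriv i (partialDeriv i f) x

theorem laplacian_eq_lap (hf : ContDiff ℝ ∞ f) : Δ f = lap f := by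
  funext x
  rw [InnerProductSpace.laplacian_eq_iteratedFDeriv_orthonormalBasis f
    (EuclideanSpace.basisFun (Fin 3) ℝ)]
  refine Finset.sum_congr rfl fun i _ => ?_
  rw [iteratedFDeriv_two_apply]
  have hd : DifferentiableAt ℝ (fderiv ℝ f) x :=
    (hf.fderiv_right (m := ∞) (by simp)).differentiable (by simp) x
  have h : partialDeriv i f = fun y => fderiv ℝ f y (EuclideanSpace.single i 1) := rfl
  have h' : partialDeriv i (partialDeriv i f) x
    = fderiv ℝ (partialDeriv i f) x (EuclideanSpace.single i 1) := rfl
  rw [h', h, fderiv_clm_apply hd (differentiableAt_const _)]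
  simp

theorem lap_smooth (hf : ContDiff ℝ ∞ f) : ContDiff ℝ ∞ (lap f) :=
  ContDiff.sum fun i _ => partialDeriv_smooth (partialDeriv_smooth hf i) i

theorem lap_periodic {L : Submodule ℤ E3} (hf : LatticePeriodic L f) :
    LatticePeriodic L (lap f) := fun v hv x =>
  Finset.sum_congr rfl fun i _ => partialDeriv_periodic (partialDeriv_periodic hf i) i v hv x

theorem lap_add (hf : ContDiff ℝ ∞ f) (hg : ContDiff ℝ ∞ g) :
    lap (fun x => f x + g x) = fun x => lap f x + lap g x := by
  funext x
  simp only [lap, ← Finset.sum_add_distrib]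
  refine Finset.sum_congr rfl fun i _ => ?_
  rw [partialDeriv_add hf hg, partialDeriv_add (partialDeriv_smooth hf i)
    (partialDeriv_smooth hg i)]

theorem lap_const_mul (hf : ContDiff ℝ ∞ f) (a : ℝ) :
    lap (fun x => a * f x) = fun x => a * lap f x := by
  funext x
  simp only [lap, Finset.mul_sum]
  refine Finset.sum_congr rfl fun i _ => ?_
  rw [partialDeriv_const_mul hf, partialDeriv_const_mul (partialDeriv_smooth hf i)]

theorem lap_sub (hf : ContDiff ℝ ∞ f) (hg : ContDiff ℝ ∞ g) :
    lap (fun x => f x - g x) = fun x => lap f x - lap g x := by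
  have h : (fun x => f x - g x) = fun x => f x + (-1) * g x := by funext x; ring
  rw [h, lap_add hf (contDiff_const.mul hg), lap_const_mul hg]
  funext x; ring

theorem spatialDeriv_lap (hf : ContDiff ℝ ∞ f) (α : List (Fin 3)) :
    spatialDeriv α (lap f) = lap (spatialDeriv α f) := by
  unfold lap
  rw [spatialDeriv_sum _ fun i => partialDeriv_smooth (partialDeriv_smooth hf i) i]
  funext x
  refine Finset.sum_congr rfl fun i _ => ?_
  rw [spatialDeriv_partialDeriv_comm (partialDeriv_smooth hf i),
    spatialDeriv_partialDeriv_comm hf]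

theorem lap_iterate_smooth (hf : ContDiff ℝ ∞ f) (j : ℕ) : ContDiff ℝ ∞ (lap^[j] f) := by
  induction j with
  | zero => exact hf
  | succ j ih => rw [Function.iterate_succ_apply']; exact lap_smooth ih

theorem lap_iterate_periodic {L : Submodule ℤ E3} (hf : LatticePeriodic L f) (j : ℕ) :
    LatticePeriodic L (lap^[j] f) := by
  induction j with
  | zero => exact hf
  | succ j ih => rw [Function.iterate_succ_apply']; exact lap_periodic ih

/-- Compactness of the torus: a continuous periodic function has compact range. -/
theorem exists_bound_of_periodic {L : Submodule ℤ E3} [DiscreteTopology L] [IsZLattice ℝ L]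
    (hc : Continuous f) (hf : LatticePeriodic L f) : ∃ C, ∀ x, |f x| ≤ C := by
  have h : IsCompact (Set.range f) :=
    IsZLattice.isCompact_range_of_periodic L f hc fun z w hw => hf w hw z
  obtain ⟨C, hC⟩ := h.isBounded.exists_norm_le
  exact ⟨C, fun x => hC _ ⟨x, rfl⟩⟩

end Spatial

/-! ### Joint smoothness; commuting time and space derivatives. -/

section SpaceTime

/-- Smoothness of a function of time and space in all variables together. -/
def JointlySmooth (F : ℝ → E3 → ℝ) : Prop := ContDiff ℝ ∞ fun p : ℝ × E3 => F p.1 p.2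

/-- The derivative with respect to time. -/
noncomputable def timeDeriv (F : ℝ → E3 → ℝ) : ℝ → E3 → ℝ := fun τ x => deriv (fun s => F s x) τ

variable {F G : ℝ → E3 → ℝ}

theorem JointlySmooth.space (hF : JointlySmooth F) (τ : ℝ) : ContDiff ℝ ∞ (F τ) :=
  ContDiff.comp (g := fun p : ℝ × E3 => F p.1 p.2) hF (contDiff_const.prodMk contDiff_id)

theorem JointlySmooth.time (hF : JointlySmooth F) (x : E3) : ContDiff ℝ ∞ fun τ => F τ x :=
  ContDiff.comp (g := fun p : ℝ × E3 => F p.1 p.2) hF (contDiff_id.prodMk contDiff_const)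

theorem JointlySmooth.hasDerivAt (hF : JointlySmooth F) (τ : ℝ) (x : E3) :
    HasDerivAt (fun s => F s x) (timeDeriv F τ x) τ :=
  ((hF.time x).differentiable (by simp) τ).hasDerivAt

theorem JointlySmooth.continuous (hF : JointlySmooth F) :
    Continuous fun p : ℝ × E3 => F p.1 p.2 := ContDiff.continuous hF

theorem JointlySmooth.timeDeriv_eq (hF : JointlySmooth F) (τ : ℝ) (x : E3) :
    timeDeriv F τ x = fderiv ℝ (fun p : ℝ × E3 => F p.1 p.2) (τ, x) (1, 0) := by
  have h1 : HasFDerivAt (fun p : ℝ × E3 => F p.1 p.2) _ (τ, x) :=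
    (ContDiff.differentiable hF (by simp) (τ, x)).hasFDerivAt
  have h2 : HasDerivAt (fun s : ℝ => (s, x)) ((1 : ℝ), (0 : E3)) τ :=
    (hasDerivAt_id τ).prodMk (hasDerivAt_const τ x)
  exact (h1.comp_hasDerivAt τ h2).deriv

theorem JointlySmooth.partialDeriv_eq (hF : JointlySmooth F) (i : Fin 3) (τ : ℝ) (x : E3) :
    partialDeriv i (F τ) x
      = fderiv ℝ (fun p : ℝ × E3 => F p.1 p.2) (τ, x) (0, EuclideanSpace.single i 1) := by
  have h1 : HasFDerivAt (fun p : ℝ × E3 => F p.1 p.2) _ (τ, x) :=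
    (ContDiff.differentiable hF (by simp) (τ, x)).hasFDerivAt
  have h2 : HasFDerivAt (fun y : E3 => (τ, y)) (ContinuousLinearMap.inr ℝ ℝ E3) x :=
    hasFDerivAt_prodMk_right τ x
  have h3 : HasFDerivAt (F τ) _ x := h1.comp x h2
  simp only [partialDeriv]
  rw [h3.fderiv]
  rfl

theorem JointlySmooth.timeDeriv (hF : JointlySmooth F) : JointlySmooth (timeDeriv F) := by
  have : (fun p : ℝ × E3 => _root_.timeDeriv F p.1 p.2)
      = fun p => fderiv ℝ (fun p : ℝ × E3 => F p.1 p.2) p (1, 0) :=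
    funext fun p => hF.timeDeriv_eq p.1 p.2
  unfold JointlySmooth
  rw [this]
  exact contDiff_fderiv_apply hF _

theorem JointlySmooth.partialDeriv (hF : JointlySmooth F) (i : Fin 3) :
    JointlySmooth fun τ => partialDeriv i (F τ) := by
  have : (fun p : ℝ × E3 => _root_.partialDeriv i (F p.1) p.2)
      = fun p => fderiv ℝ (fun p : ℝ × E3 => F p.1 p.2) p (0, EuclideanSpace.single i 1) :=
    funext fun p => hF.partialDeriv_eq i p.1 p.2
  unfold JointlySmooth
  rw [this]
  exact contDiff_fderiv_apply hF _

theorem JointlySmooth.timeDeriv_partialDeriv (hF : JointlySmooth F) (i : Fin 3) (τ : ℝ) :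
    _root_.timeDeriv (fun τ => _root_.partialDeriv i (F τ)) τ
      = _root_.partialDeriv i (_root_.timeDeriv F τ) := by
  funext x
  rw [(hF.partialDeriv i).timeDeriv_eq, hF.timeDeriv.partialDeriv_eq]
  have h1 : (fun p : ℝ × E3 => _root_.partialDeriv i (F p.1) p.2)
      = fun p => fderiv ℝ (fun p : ℝ × E3 => F p.1 p.2) p (0, EuclideanSpace.single i 1) :=
    funext fun p => hF.partialDeriv_eq i p.1 p.2
  have h2 : (fun p : ℝ × E3 => _root_.timeDeriv F p.1 p.2)
      = fun p => fderiv ℝ (fun p : ℝ × E3 => F p.1 p.2) p (1, 0) :=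
    funext fun p => hF.timeDeriv_eq p.1 p.2
  rw [h1, h2]
  exact fderiv_fderiv_apply_comm hF _ _ _

theorem JointlySmooth.spatialDeriv (hF : JointlySmooth F) (α : List (Fin 3)) :
    JointlySmooth fun τ => spatialDeriv α (F τ) := by
  induction α with
  | nil => exact hF
  | cons i α ih => exact ih.partialDeriv i

theorem JointlySmooth.timeDeriv_spatialDeriv (hF : JointlySmooth F) (α : List (Fin 3)) (τ : ℝ) :
    _root_.timeDeriv (fun τ => _root_.spatialDeriv α (F τ)) τ
      = _root_.spatialDeriv α (_root_.timeDeriv F τ) := by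
  induction α with
  | nil => rfl
  | cons i α ih =>
    rw [spatialDeriv_cons, ← ih]
    exact (hF.spatialDeriv α).timeDeriv_partialDeriv i τ

theorem JointlySmooth.lap (hF : JointlySmooth F) : JointlySmooth fun τ => lap (F τ) :=
  ContDiff.sum fun i _ => (hF.partialDeriv i).partialDeriv i

theorem JointlySmooth.add (hF : JointlySmooth F) (hG : JointlySmooth G) :
    JointlySmooth fun τ x => F τ x + G τ x := ContDiff.add hF hG

theorem JointlySmooth.sub (hF : JointlySmooth F) (hG : JointlySmooth G) :
    JointlySmooth fun τ x => F τ x - G τ x := ContDiff.sub hF hG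

theorem JointlySmooth.mul (hF : JointlySmooth F) (hG : JointlySmooth G) :
    JointlySmooth fun τ x => F τ x * G τ x := ContDiff.mul hF hG

theorem JointlySmooth.sum {ι : Type*} {s : Finset ι} {F : ι → ℝ → E3 → ℝ}
    (hF : ∀ i, JointlySmooth (F i)) : JointlySmooth fun τ x => ∑ i ∈ s, F i τ x :=
  ContDiff.sum fun i _ => hF i

theorem jointlySmooth_of_time {a : ℝ → ℝ} (ha : ContDiff ℝ ∞ a) : JointlySmooth fun τ _ => a τ :=
  ha.comp contDiff_fst

theorem jointlySmooth_of_space {f : E3 → ℝ} (hf : ContDiff ℝ ∞ f) : JointlySmooth fun _ => f :=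
  hf.comp contDiff_snd

theorem timeDeriv_sub (hF : JointlySmooth F) (hG : JointlySmooth G) :
    timeDeriv (fun τ x => F τ x - G τ x) = fun τ x => timeDeriv F τ x - timeDeriv G τ x :=
  funext fun τ => funext fun x => ((hF.hasDerivAt τ x).sub (hG.hasDerivAt τ x)).deriv

theorem timeDeriv_add (hF : JointlySmooth F) (hG : JointlySmooth G) :
    timeDeriv (fun τ x => F τ x + G τ x) = fun τ x => timeDeriv F τ x + timeDeriv G τ x :=
  funext fun τ => funext fun x => ((hF.hasDerivAt τ x).add (hG.hasDerivAt τ x)).deriv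

end SpaceTime

/-! ### Averages along segments, in place of integrals over the torus. -/

section Averages

/-- The average of a continuous function over the segments from `x` to `x + b`. -/
noncomputable def lineAvg (b : E3) : C(E3, ℝ) →ₗ[ℝ] C(E3, ℝ) where
  toFun f := ⟨fun x => ∫ t in (0 : ℝ)..1, f (x + t • b),
    intervalIntegral.continuous_parametric_intervalIntegral_of_continuous'
      (f := fun x t => f (x + t • b)) (by fun_prop) 0 1⟩
  map_add' f g := by
    ext x
    exact intervalIntegral.integral_add
      (Continuous.intervalIntegrable (by fun_prop) _ _)
      (Continuous.intervalIntegrable (by fun_prop) _ _)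
  map_smul' a f := by
    ext x
    exact intervalIntegral.integral_const_mul _ _

theorem lineAvg_apply (b : E3) (f : C(E3, ℝ)) (x : E3) :
    lineAvg b f x = ∫ t in (0 : ℝ)..1, f (x + t • b) := rfl

theorem lineAvg_monotone (b : E3) : Monotone (lineAvg b) := by
  intro f g h x
  exact intervalIntegral.integral_mono_on zero_le_one
    (Continuous.intervalIntegrable (by fun_prop) _ _)
    (Continuous.intervalIntegrable (by fun_prop) _ _) fun t _ => h _

theorem lineAvg_const (b : E3) (a : ℝ) : lineAvg b (ContinuousMap.const E3 a)
    = ContinuousMap.const E3 a := by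
  ext x
  simp [lineAvg_apply]

/-- Fubini. It allows any one of several averages to be applied first. -/
theorem lineAvg_comm (b c : E3) (f : C(E3, ℝ)) :
    lineAvg b (lineAvg c f) = lineAvg c (lineAvg b f) := by
  ext x
  simp only [lineAvg_apply]
  rw [MeasureTheory.intervalIntegral_intervalIntegral_swap]
  · refine intervalIntegral.integral_congr fun s _ => intervalIntegral.integral_congr fun t _ => ?_
    exact congrArg f (by abel)
  · have hc : Continuous fun p : ℝ × ℝ => f (x + p.1 • b + p.2 • c) := by fun_prop
    refine MeasureTheory.IntegrableOn.mono_set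
      (hc.continuousOn.integrableOn_compact
        ((isCompact_uIcc (a := (0 : ℝ)) (b := 1)).prod (isCompact_uIcc (a := (0 : ℝ)) (b := 1)))) ?_
    exact Set.prod_mono Set.uIoc_subset_uIcc Set.uIoc_subset_uIcc

/-- The values of a continuous function of space and time at a given time. -/
def slice (F : ℝ → E3 → ℝ) (hF : Continuous fun p : ℝ × E3 => F p.1 p.2) (τ : ℝ) : C(E3, ℝ) :=
  ⟨F τ, hF.comp (by fun_prop : Continuous fun x : E3 => (τ, x))⟩

theorem lineAvg_slice_continuous (b : E3) {F : ℝ → E3 → ℝ}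
    (hF : Continuous fun p : ℝ × E3 => F p.1 p.2) :
    Continuous fun p : ℝ × E3 => lineAvg b (slice F hF p.1) p.2 :=
  intervalIntegral.continuous_parametric_intervalIntegral_of_continuous'
    (f := fun (p : ℝ × E3) (t : ℝ) => F p.1 (p.2 + t • b))
    (hF.comp (by fun_prop : Continuous fun q : (ℝ × E3) × ℝ => (q.1.1, q.1.2 + q.2 • b))) 0 1

/-- Differentiation under the integral sign, dominated by the maximum of `F'` over a compact time
interval around `τ` and the segment. -/
theorem lineAvg_slice_hasDerivAt (b : E3) {F F' : ℝ → E3 → ℝ}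
    (hF : Continuous fun p : ℝ × E3 => F p.1 p.2) (hF' : Continuous fun p : ℝ × E3 => F' p.1 p.2)
    (h : ∀ τ x, HasDerivAt (fun s => F s x) (F' τ x) τ) (τ : ℝ) (x : E3) :
    HasDerivAt (fun s => lineAvg b (slice F hF s) x) (lineAvg b (slice F' hF' τ) x) τ := by
  have hc : ∀ G : ℝ → E3 → ℝ, (Continuous fun p : ℝ × E3 => G p.1 p.2) →
      Continuous fun q : ℝ × ℝ => G q.1 (x + q.2 • b) := fun G hG =>
    hG.comp (by fun_prop : Continuous fun q : ℝ × ℝ => (q.1, x + q.2 • b))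
  have hs : ∀ G : ℝ → E3 → ℝ, (Continuous fun p : ℝ × E3 => G p.1 p.2) → ∀ s,
      Continuous fun t : ℝ => G s (x + t • b) := fun G hG s =>
    (hc G hG).comp (by fun_prop : Continuous fun t : ℝ => (s, t))
  obtain ⟨C, hC⟩ := ((isCompact_Icc (a := τ - 1) (b := τ + 1)).prod
    (isCompact_uIcc (a := (0 : ℝ)) (b := 1))).exists_bound_of_continuousOn (hc F' hF').continuousOn
  refine (intervalIntegral.hasDerivAt_integral_of_dominated_loc_of_deriv_le
    (F := fun s t => F s (x + t • b)) (F' := fun s t => F' s (x + t • b)) (bound := fun _ => C)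
    (Icc_mem_nhds (by linarith : τ - 1 < τ) (by linarith : τ < τ + 1))
    (Filter.Eventually.of_forall fun s => (hs F hF s).aestronglyMeasurable)
    ((hs F hF τ).intervalIntegrable _ _) (hs F' hF' τ).aestronglyMeasurable ?_
    intervalIntegrable_const ?_).2
  · exact Filter.Eventually.of_forall fun t ht s hs =>
      hC (s, t) ⟨hs, Set.uIoc_subset_uIcc ht⟩
  · exact Filter.Eventually.of_forall fun t _ s _ => h s _

theorem fderiv_apply_eq_sum_partialDeriv (f : E3 → ℝ) (x v : E3) :
    fderiv ℝ f x v = ∑ i, v i * partialDeriv i f x := by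
  have h : v = ∑ i, v i • EuclideanSpace.single i (1 : ℝ) := by
    ext j
    simp [Finset.sum_apply, Pi.single_apply]
  conv_lhs => rw [h]
  simp [partialDeriv]

theorem hasDerivAt_line {f : E3 → ℝ} (hf : ContDiff ℝ ∞ f) (x b : E3) (t : ℝ) :
    HasDerivAt (fun s : ℝ => f (x + s • b)) (fderiv ℝ f (x + t • b) b) t := by
  have h1 := (hf.differentiable (by simp) (x + t • b)).hasFDerivAt
  have h2 : HasDerivAt (fun s : ℝ => x + s • b) b t := by
    simpa using ((hasDerivAt_id t).smul_const b).const_add x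
  exact h1.comp_hasDerivAt t h2

/-- The directional derivative of a smooth function. -/
noncomputable def dirDeriv (b : E3) {f : E3 → ℝ} (hf : ContDiff ℝ ∞ f) : C(E3, ℝ) :=
  ⟨fun x => fderiv ℝ f x b, (contDiff_fderiv_apply hf b).continuous⟩

/-- The fundamental theorem of calculus along a period; this is what replaces integration by parts.
-/
theorem lineAvg_dirDeriv (b : E3) {f : E3 → ℝ} (hf : ContDiff ℝ ∞ f)
    (hb : ∀ x, f (x + b) = f x) : lineAvg b (dirDeriv b hf) = 0 := by
  ext x
  have := intervalIntegral.integral_eq_sub_of_hasDerivAt (a := 0) (b := 1)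
    (fun t _ => hasDerivAt_line hf x b t)
    (Continuous.intervalIntegrable
      ((contDiff_fderiv_apply hf b).continuous.comp (by fun_prop)) _ _)
  rw [lineAvg_apply]
  refine this.trans ?_
  simp [hb]

/-- The one-dimensional Sobolev inequality: `f x` differs from `f (x + t • b)` by at most the
integral of the derivative; then average over `t`. -/
theorem abs_le_lineAvg (b : E3) {f : E3 → ℝ} (hf : ContDiff ℝ ∞ f) :
    |(⟨f, hf.continuous⟩ : C(E3, ℝ))|
      ≤ lineAvg b |(⟨f, hf.continuous⟩ : C(E3, ℝ))| + lineAvg b |dirDeriv b hf| := by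
  intro x
  have hd : Continuous fun t : ℝ => fderiv ℝ f (x + t • b) b :=
    (contDiff_fderiv_apply hf b).continuous.comp (by fun_prop)
  have hfc : Continuous fun t : ℝ => f (x + t • b) := hf.continuous.comp (by fun_prop)
  have key : ∀ t ∈ Set.Icc (0 : ℝ) 1,
      |f x| ≤ |f (x + t • b)| + ∫ s in (0 : ℝ)..1, |fderiv ℝ f (x + s • b) b| := by
    intro t ht
    have h1 := intervalIntegral.integral_eq_sub_of_hasDerivAt (a := 0) (b := t)
      (fun s _ => hasDerivAt_line hf x b s) (hd.intervalIntegrable _ _)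
    simp only [zero_smul, add_zero] at h1
    have h2 : |∫ s in (0 : ℝ)..t, fderiv ℝ f (x + s • b) b|
        ≤ ∫ s in (0 : ℝ)..t, |fderiv ℝ f (x + s • b) b| :=
      intervalIntegral.abs_integral_le_integral_abs ht.1
    have h3 : ∫ s in (0 : ℝ)..t, |fderiv ℝ f (x + s • b) b|
        ≤ ∫ s in (0 : ℝ)..1, |fderiv ℝ f (x + s • b) b| :=
      intervalIntegral.integral_mono_interval le_rfl ht.1 ht.2
        (Filter.Eventually.of_forall fun s => abs_nonneg _) (hd.abs.intervalIntegrable _ _)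
    have h4 : f x = f (x + t • b) - ∫ s in (0 : ℝ)..t, fderiv ℝ f (x + s • b) b := by
      rw [h1]; ring
    calc |f x| = |f (x + t • b) - ∫ s in (0 : ℝ)..t, fderiv ℝ f (x + s • b) b| := by rw [← h4]
      _ ≤ _ := (abs_sub _ _).trans (by linarith)
  have hadd := intervalIntegral.integral_add (a := 0) (b := 1) (μ := MeasureTheory.volume)
    (hfc.abs.intervalIntegrable 0 1) (continuous_const.intervalIntegrable
      (u := fun _ : ℝ => ∫ s in (0 : ℝ)..1, |fderiv ℝ f (x + s • b) b|) 0 1)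
  have := intervalIntegral.integral_mono_on (a := 0) (b := 1) (μ := MeasureTheory.volume)
    zero_le_one (continuous_const.intervalIntegrable _ _)
    ((hfc.abs.fun_add continuous_const).intervalIntegrable _ _) key
  rw [hadd, intervalIntegral.integral_const, intervalIntegral.integral_const, sub_zero, one_smul,
    one_smul] at this
  exact this

end Averages

/-! ### The weighted energy estimate. -/

section Energy

/-- The average over the parallelepiped spanned by three vectors. -/
noncomputable def boxAvg (b : Fin 3 → E3) : C(E3, ℝ) →ₗ[ℝ] C(E3, ℝ) :=
  lineAvg (b 0) ∘ₗ lineAvg (b 1) ∘ₗ lineAvg (b 2)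

theorem boxAvg_apply (b : Fin 3 → E3) (f : C(E3, ℝ)) :
    boxAvg b f = lineAvg (b 0) (lineAvg (b 1) (lineAvg (b 2) f)) := rfl

theorem boxAvg_monotone (b : Fin 3 → E3) : Monotone (boxAvg b) :=
  (lineAvg_monotone _).comp ((lineAvg_monotone _).comp (lineAvg_monotone _))

theorem boxAvg_const (b : Fin 3 → E3) (a : ℝ) :
    boxAvg b (ContinuousMap.const E3 a) = ContinuousMap.const E3 a := by
  simp only [boxAvg_apply, lineAvg_const]

theorem boxAvg_dirDeriv {L : Submodule ℤ E3} (b : Fin 3 → E3) (hb : ∀ j, b j ∈ L) {f : E3 → ℝ}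
    (hf : ContDiff ℝ ∞ f) (hp : LatticePeriodic L f) (j : Fin 3) :
    boxAvg b (dirDeriv (b j) hf) = 0 := by
  have h : lineAvg (b j) (dirDeriv (b j) hf) = 0 := lineAvg_dirDeriv _ hf (hp _ (hb j))
  rw [boxAvg_apply]
  fin_cases j
  · simp only [Fin.zero_eta] at h ⊢
    rw [lineAvg_comm (b 1), lineAvg_comm (b 0), lineAvg_comm (b 0), h]
    simp
  · simp only [Fin.mk_one] at h ⊢
    rw [lineAvg_comm (b 1), h]
    simp
  · simp only [Fin.reduceFinMk] at h ⊢
    rw [h]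
    simp

/-- The coordinate vector is a combination of lattice vectors, and each lattice direction
contributes zero. Hence divergences of periodic fields have zero average. -/
theorem boxAvg_partialDeriv {L : Submodule ℤ E3} (b : Module.Basis (Fin 3) ℝ E3)
    (hb : ∀ j, b j ∈ L) {f : E3 → ℝ} (hf : ContDiff ℝ ∞ f) (hp : LatticePeriodic L f) (i : Fin 3) :
    boxAvg b (⟨partialDeriv i f, (partialDeriv_smooth hf i).continuous⟩ : C(E3, ℝ)) = 0 := by
  have h : (⟨partialDeriv i f, (partialDeriv_smooth hf i).continuous⟩ : C(E3, ℝ))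
      = ∑ j, b.repr (EuclideanSpace.single i 1) j • dirDeriv (b j) hf := by
    ext x
    have := b.sum_repr (EuclideanSpace.single i (1 : ℝ))
    simp only [ContinuousMap.coe_mk, partialDeriv, ContinuousMap.coe_sum, Finset.sum_apply,
      ContinuousMap.coe_smul, Pi.smul_apply, dirDeriv]
    conv_lhs => rw [← this, map_sum]
    simp only [map_smul]
  rw [h, map_sum]
  refine Finset.sum_eq_zero fun j _ => ?_
  rw [map_smul, boxAvg_dirDeriv b hb hf hp, smul_zero]

theorem boxAvg_slice_hasDerivAt (b : Fin 3 → E3) {F F' : ℝ → E3 → ℝ}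
    (hF : Continuous fun p : ℝ × E3 => F p.1 p.2) (hF' : Continuous fun p : ℝ × E3 => F' p.1 p.2)
    (h : ∀ τ x, HasDerivAt (fun s => F s x) (F' τ x) τ) (τ : ℝ) (x : E3) :
    HasDerivAt (fun s => boxAvg b (slice F hF s) x) (boxAvg b (slice F' hF' τ) x) τ :=
  lineAvg_slice_hasDerivAt (b 0)
    (lineAvg_slice_continuous (b 1) (lineAvg_slice_continuous (b 2) hF))
    (lineAvg_slice_continuous (b 1) (lineAvg_slice_continuous (b 2) hF'))
    (lineAvg_slice_hasDerivAt (b 1) (lineAvg_slice_continuous (b 2) hF)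
      (lineAvg_slice_continuous (b 2) hF') (lineAvg_slice_hasDerivAt (b 2) hF hF' h)) τ x

/-- `u'' + 2 ν u' = w e^{2 τ} Δ u + h`, the wave equation in the logarithmic time `τ = log η`. -/
def SolvesWave (ν w : ℝ) (h u : ℝ → E3 → ℝ) : Prop :=
  ∀ τ x, timeDeriv (timeDeriv u) τ x + 2 * ν * timeDeriv u τ x
    = w * Real.exp (2 * τ) * lap (u τ) x + h τ x

variable {ν w : ℝ} {L : Submodule ℤ E3} {u : ℝ → E3 → ℝ}

theorem timeDeriv_periodic (hp : ∀ τ, LatticePeriodic L (u τ)) (τ : ℝ) :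
    LatticePeriodic L (timeDeriv u τ) := by
  intro v hv x
  have : (fun s => u s (x + v)) = fun s => u s x := funext fun s => hp s v hv x
  simp only [timeDeriv, this]

/-- The coefficients of the equation depend on time only, so it commutes with spatial derivatives.
-/
theorem SolvesWave.spatialDeriv {h : ℝ → E3 → ℝ} (hu : JointlySmooth u) (hh : JointlySmooth h)
    (hs : SolvesWave ν w h u) (α : List (Fin 3)) :
    SolvesWave ν w (fun τ => spatialDeriv α (h τ)) (fun τ => spatialDeriv α (u τ)) := by
  intro τ x
  have h1 : timeDeriv (fun τ => _root_.spatialDeriv α (u τ))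
      = fun τ => _root_.spatialDeriv α (timeDeriv u τ) :=
    funext fun τ => hu.timeDeriv_spatialDeriv α τ
  rw [h1, hu.timeDeriv.timeDeriv_spatialDeriv α τ, ← spatialDeriv_lap (hu.space τ)]
  have hs' : (fun x => timeDeriv (timeDeriv u) τ x + 2 * ν * timeDeriv u τ x)
    = fun x => w * Real.exp (2 * τ) * lap (u τ) x + h τ x := funext (hs τ)
  have := congrFun (congrArg (_root_.spatialDeriv α) hs') x
  rw [spatialDeriv_add (hu.timeDeriv.timeDeriv.space τ)
    (contDiff_const.mul (hu.timeDeriv.space τ)),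
    spatialDeriv_const_mul (hu.timeDeriv.space τ),
    spatialDeriv_add (contDiff_const.mul (hu.lap.space τ)) (hh.space τ),
    spatialDeriv_const_mul (hu.lap.space τ)] at this
  exact this

/-- The averaged weighted energy is nondecreasing in `τ`, so for `τ ≤ 0` it is at most its value at
`τ = 0`, which is bounded by periodicity. The gradient part of the energy is nonnegative and can be
dropped. -/
theorem boxAvg_sq_timeDeriv_le [DiscreteTopology L] [IsZLattice ℝ L]
    (b : Module.Basis (Fin 3) ℝ E3) (hb : ∀ j, b j ∈ L) (hν : 0 ≤ ν) (hw : 0 ≤ w)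
    (hu : JointlySmooth u) (hp : ∀ τ, LatticePeriodic L (u τ))
    (hs : SolvesWave ν w (fun _ _ => 0) u) :
    ∃ C, ∀ τ ≤ 0, ∀ x,
      boxAvg b (slice (fun τ x => timeDeriv u τ x * timeDeriv u τ x)
        (hu.timeDeriv.mul hu.timeDeriv).continuous τ) x ≤ C * Real.exp (-4 * ν * τ) := by
  set G : ℝ → E3 → ℝ := fun τ x => ∑ i, partialDeriv i (u τ) x * partialDeriv i (u τ) x with hG
  have hGs : JointlySmooth G := JointlySmooth.sum fun i => (hu.partialDeriv i).mul (hu.partialDeriv i)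
  have hG0 : ∀ τ x, 0 ≤ G τ x := fun τ x => Finset.sum_nonneg fun i _ => mul_self_nonneg _
  have hexp : ∀ a : ℝ, ContDiff ℝ ∞ fun τ : ℝ => Real.exp (a * τ) := fun a => by fun_prop
  -- The weight `e^{4ντ}` is chosen so that its derivative cancels the damping contribution
  -- `-4νu'²`.
  set F : ℝ → E3 → ℝ := fun τ x => Real.exp (4 * ν * τ)
    * (timeDeriv u τ x * timeDeriv u τ x + w * Real.exp (2 * τ) * G τ x) with hF
  have hFs : JointlySmooth F := (jointlySmooth_of_time (hexp _)).mul
    ((hu.timeDeriv.mul hu.timeDeriv).add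
      ((jointlySmooth_of_time (contDiff_const.mul (hexp 2))).mul hGs))
  set V : Fin 3 → ℝ → E3 → ℝ := fun i τ x => timeDeriv u τ x * partialDeriv i (u τ) x with hV
  have hVs : ∀ i, JointlySmooth (V i) := fun i => hu.timeDeriv.mul (hu.partialDeriv i)
  -- The terms `u'Δu` and `∇u·∇u'` combine into the divergence of `u'∇u`, which averages to zero;
  -- what is left is a nonnegative multiple of `|∇u|²`.
  set F' : ℝ → E3 → ℝ := fun τ x => Real.exp (4 * ν * τ)
    * (2 * w * Real.exp (2 * τ) * (∑ i, partialDeriv i (V i τ) x)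
      + (4 * ν + 2) * w * Real.exp (2 * τ) * G τ x) with hF'
  have hF's : JointlySmooth F' := (jointlySmooth_of_time (hexp _)).mul
    (((jointlySmooth_of_time (contDiff_const.mul (hexp 2))).mul
      (JointlySmooth.sum fun i => (hVs i).partialDeriv i)).add
      ((jointlySmooth_of_time (contDiff_const.mul (hexp 2))).mul hGs))
  have hder : ∀ τ x, HasDerivAt (fun s => F s x) (F' τ x) τ := by
    intro τ x
    have he : ∀ a : ℝ, HasDerivAt (fun s : ℝ => Real.exp (a * s)) (Real.exp (a * τ) * a) τ := by
      intro a
      simpa using ((hasDerivAt_id τ).const_mul a).exp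
    have h1 := hu.timeDeriv.hasDerivAt τ x
    have h2 : ∀ i, HasDerivAt (fun s => partialDeriv i (u s) x) (partialDeriv i (timeDeriv u τ) x) τ := by
      intro i
      have := (hu.partialDeriv i).hasDerivAt τ x
      rwa [hu.timeDeriv_partialDeriv i τ] at this
    have h3 : HasDerivAt (fun s => G s x) (∑ i, (partialDeriv i (timeDeriv u τ) x
        * partialDeriv i (u τ) x + partialDeriv i (u τ) x * partialDeriv i (timeDeriv u τ) x)) τ :=
      HasDerivAt.fun_sum fun i _ => (h2 i).mul (h2 i)
    have h4 := (he (4 * ν)).mul ((h1.mul h1).add (((he 2).const_mul w).mul h3))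
    refine h4.congr_deriv ?_
    have h5 : ∀ i, partialDeriv i (V i τ) x = timeDeriv u τ x * partialDeriv i (partialDeriv i (u τ)) x
        + partialDeriv i (timeDeriv u τ) x * partialDeriv i (u τ) x := fun i =>
      partialDeriv_mul (hu.timeDeriv.space τ) (partialDeriv_smooth (hu.space τ) i) i x
    have h6 := hs τ x
    have h7 : timeDeriv (timeDeriv u) τ x = w * Real.exp (2 * τ) * lap (u τ) x
      - 2 * ν * timeDeriv u τ x := by linarith
    rw [h7]
    simp only [hF', hG, h5, lap, Fin.sum_univ_three, Pi.mul_apply, Pi.add_apply]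
    ring
  have hnonneg : ∀ τ x, 0 ≤ boxAvg b (slice F' hF's.continuous τ) x := by
    intro τ x
    have hsplit : slice F' hF's.continuous τ
        = (Real.exp (4 * ν * τ) * (2 * w * Real.exp (2 * τ))) • (∑ i, (⟨partialDeriv i (V i τ),
          (partialDeriv_smooth ((hVs i).space τ) i).continuous⟩ : C(E3, ℝ)))
          + (Real.exp (4 * ν * τ) * ((4 * ν + 2) * w * Real.exp (2 * τ)))
            • slice G hGs.continuous τ := by
      ext y
      simp only [slice, hF', ContinuousMap.coe_mk, ContinuousMap.add_apply, ContinuousMap.smul_apply,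
        ContinuousMap.coe_sum, Finset.sum_apply, smul_eq_mul]
      ring
    have hVp : ∀ i, LatticePeriodic L (V i τ) := fun i v hv y => by
      simp only [hV]
      rw [timeDeriv_periodic hp τ v hv, partialDeriv_periodic (hp τ) i v hv]
    rw [hsplit, map_add, map_smul, map_sum, Finset.sum_eq_zero fun i _ =>
      boxAvg_partialDeriv b hb ((hVs i).space τ) (hVp i) i, smul_zero, zero_add, map_smul]
    have hpos : 0 ≤ boxAvg b (slice G hGs.continuous τ) x := by
      have := boxAvg_monotone b (show (0 : C(E3, ℝ)) ≤ slice G hGs.continuous τ from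
        fun y => hG0 τ y) x
      simpa using this
    exact mul_nonneg (by positivity) hpos
  obtain ⟨C, hC⟩ := exists_bound_of_periodic (L := L) (hFs.space 0).continuous (by
    intro v hv y
    simp only [hF, hG]
    rw [timeDeriv_periodic hp 0 v hv]
    simp only [partialDeriv_periodic (hp 0) _ v hv])
  refine ⟨C, fun τ hτ x => ?_⟩
  have hmono : Monotone fun s => boxAvg b (slice F hFs.continuous s) x :=
    monotone_of_hasDerivAt_nonneg (fun s => boxAvg_slice_hasDerivAt b hFs.continuous
      hF's.continuous hder s x) fun s => hnonneg s x
  have h0 : boxAvg b (slice F hFs.continuous 0) x ≤ C := by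
    have := boxAvg_monotone b (show slice F hFs.continuous 0 ≤ ContinuousMap.const E3 C from
      fun y => (le_abs_self _).trans (hC y)) x
    rwa [boxAvg_const] at this
  have h1 : boxAvg b (slice F hFs.continuous τ) x ≤ C := (hmono hτ).trans h0
  have h2 : Real.exp (4 * ν * τ) * boxAvg b (slice (fun τ x => timeDeriv u τ x * timeDeriv u τ x)
        (hu.timeDeriv.mul hu.timeDeriv).continuous τ) x
      ≤ boxAvg b (slice F hFs.continuous τ) x := by
    have h3 : Real.exp (4 * ν * τ) • slice (fun τ x => timeDeriv u τ x * timeDeriv u τ x)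
        (hu.timeDeriv.mul hu.timeDeriv).continuous τ ≤ slice F hFs.continuous τ := by
      intro y
      refine mul_le_mul_of_nonneg_left ?_ (Real.exp_nonneg _)
      have := hG0 τ y
      have : 0 ≤ w * Real.exp (2 * τ) * G τ y := by positivity
      exact le_add_of_nonneg_right this
    have := boxAvg_monotone b h3 x
    rwa [map_smul] at this
  have h3 : Real.exp (4 * ν * τ) * Real.exp (-4 * ν * τ) = 1 := by
    rw [← Real.exp_add]; simp
  have h4 := mul_le_mul_of_nonneg_right (h2.trans h1) (Real.exp_pos (-4 * ν * τ)).le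
  rwa [mul_right_comm, h3, one_mul] at h4

/-- Instead of Cauchy–Schwarz, the pointwise inequality `|a| ≤ e/2 + a²/(2e)` is averaged, with `e`
equal to the expected size `e^{-2ντ}`. -/
theorem boxAvg_abs_timeDeriv_le [DiscreteTopology L] [IsZLattice ℝ L]
    (b : Module.Basis (Fin 3) ℝ E3) (hb : ∀ j, b j ∈ L) (hν : 0 ≤ ν) (hw : 0 ≤ w)
    (hu : JointlySmooth u) (hp : ∀ τ, LatticePeriodic L (u τ))
    (hs : SolvesWave ν w (fun _ _ => 0) u) :
    ∃ C, ∀ τ ≤ 0, ∀ x,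
      boxAvg b |slice (timeDeriv u) hu.timeDeriv.continuous τ| x ≤ C * Real.exp (-2 * ν * τ) := by
  obtain ⟨C, hC⟩ := boxAvg_sq_timeDeriv_le b hb hν hw hu hp hs
  refine ⟨(1 + C) / 2, fun τ hτ x => ?_⟩
  set e := Real.exp (-2 * ν * τ) with he
  have hep : 0 < e := Real.exp_pos _
  have he2 : Real.exp (-4 * ν * τ) = e * e := by rw [he, ← Real.exp_add]; ring_nf
  have h1 : |slice (timeDeriv u) hu.timeDeriv.continuous τ|
      ≤ ContinuousMap.const E3 (e / 2) + (1 / (2 * e)) •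
        slice (fun τ x => timeDeriv u τ x * timeDeriv u τ x)
        (hu.timeDeriv.mul hu.timeDeriv).continuous τ := by
    intro y
    change |timeDeriv u τ y| ≤ e / 2 + 1 / (2 * e) * (timeDeriv u τ y * timeDeriv u τ y)
    rw [← abs_mul_abs_self (timeDeriv u τ y)]
    generalize |timeDeriv u τ y| = a
    have : e / 2 + 1 / (2 * e) * (a * a) - a = (e - a) ^ 2 / (2 * e) := by field_simp; ring
    have h : 0 ≤ (e - a) ^ 2 / (2 * e) := by positivity
    linarith
  have h2 := boxAvg_monotone b h1 x
  rw [map_add, map_smul, boxAvg_const] at h2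
  refine h2.trans ?_
  have h3 := hC τ hτ x
  rw [he2] at h3
  change e / 2 + 1 / (2 * e) * _ ≤ _
  calc e / 2 + 1 / (2 * e) * _ ≤ e / 2 + 1 / (2 * e) * (C * (e * e)) := by gcongr
    _ = _ := by field_simp

end Energy

/-! ### Exponential bounds as `τ → -∞`, and their integration in time. -/

section Decay

/-- All spatial derivatives of `F` are `O(e^{σ τ})` as `τ → -∞`, uniformly in space. -/
def Decay (σ : ℝ) (F : ℝ → E3 → ℝ) : Prop :=
  ∀ α : List (Fin 3), ∃ C, ∀ τ ≤ 0, ∀ x, |spatialDeriv α (F τ) x| ≤ C * Real.exp (σ * τ)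

variable {σ ρ : ℝ} {F G : ℝ → E3 → ℝ}

theorem Decay.mono (h : Decay σ F) (hρ : ρ ≤ σ) : Decay ρ F := by
  intro α
  obtain ⟨C, hC⟩ := h α
  refine ⟨|C|, fun τ hτ x => (hC τ hτ x).trans ?_⟩
  have : Real.exp (σ * τ) ≤ Real.exp (ρ * τ) :=
    Real.exp_le_exp.2 (mul_le_mul_of_nonpos_right hρ hτ)
  exact mul_le_mul (le_abs_self C) this (Real.exp_nonneg _) (abs_nonneg _)

theorem Decay.add (hF : Decay σ F) (hG : Decay σ G) (hFs : JointlySmooth F)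
    (hGs : JointlySmooth G) : Decay σ fun τ x => F τ x + G τ x := by
  intro α
  obtain ⟨C, hC⟩ := hF α
  obtain ⟨D, hD⟩ := hG α
  refine ⟨C + D, fun τ hτ x => ?_⟩
  rw [spatialDeriv_add (hFs.space τ) (hGs.space τ), add_mul]
  exact (abs_add_le _ _).trans (add_le_add (hC τ hτ x) (hD τ hτ x))

theorem Decay.sub (hF : Decay σ F) (hG : Decay σ G) (hFs : JointlySmooth F)
    (hGs : JointlySmooth G) : Decay σ fun τ x => F τ x - G τ x := by
  intro α
  obtain ⟨C, hC⟩ := hF α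
  obtain ⟨D, hD⟩ := hG α
  refine ⟨C + D, fun τ hτ x => ?_⟩
  rw [spatialDeriv_sub (hFs.space τ) (hGs.space τ), add_mul]
  exact (abs_sub _ _).trans (add_le_add (hC τ hτ x) (hD τ hτ x))

theorem decay_zero : Decay σ fun _ _ => 0 := fun α =>
  ⟨0, fun τ _ x => by rw [spatialDeriv_zero]; simp⟩

theorem Decay.sum {ι : Type*} (s : Finset ι) {F : ι → ℝ → E3 → ℝ}
    (hF : ∀ i ∈ s, Decay σ (F i)) (hFs : ∀ i, JointlySmooth (F i)) :
    Decay σ fun τ x => ∑ i ∈ s, F i τ x := by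
  classical
  induction s using Finset.induction_on with
  | empty => simpa using decay_zero
  | insert j s hj ih =>
    simp only [Finset.sum_insert hj]
    exact (hF j (Finset.mem_insert_self j s)).add
      (ih fun i hi => hF i (Finset.mem_insert_of_mem hi)) (hFs j) (JointlySmooth.sum hFs)

theorem Decay.time_mul {a : ℝ → ℝ} {A : ℝ} (ha : ∀ τ ≤ 0, |a τ| ≤ A * Real.exp (ρ * τ))
    (hF : Decay σ F) (hFs : JointlySmooth F) : Decay (ρ + σ) fun τ x => a τ * F τ x := by
  intro α
  obtain ⟨C, hC⟩ := hF α
  refine ⟨A * C, fun τ hτ x => ?_⟩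
  rw [spatialDeriv_const_mul (hFs.space τ), abs_mul, add_mul, Real.exp_add]
  calc _ ≤ A * Real.exp (ρ * τ) * (C * Real.exp (σ * τ)) :=
        mul_le_mul (ha τ hτ) (hC τ hτ x) (abs_nonneg _) ((abs_nonneg _).trans (ha τ hτ))
    _ = _ := by ring

theorem Decay.spatialDeriv (h : Decay σ F) (α : List (Fin 3)) :
    Decay σ fun τ => spatialDeriv α (F τ) := by
  intro β
  obtain ⟨C, hC⟩ := h (β ++ α)
  exact ⟨C, fun τ hτ x => by rw [← spatialDeriv_append]; exact hC τ hτ x⟩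

theorem Decay.lap (h : Decay σ F) (hFs : JointlySmooth F) : Decay σ fun τ => lap (F τ) :=
  Decay.sum Finset.univ (fun i _ => h.spatialDeriv [i, i])
    fun i => (hFs.partialDeriv i).partialDeriv i

/-- Both `(C/σ) e^{σt} + g` and `(C/σ) e^{σt} - g` are nondecreasing on `t ≤ 0`. The sign of `σ`
plays no role. -/
theorem abs_sub_le_of_deriv_le_exp {g g' : ℝ → ℝ} {C σ : ℝ} (hσ : σ ≠ 0)
    (hg : ∀ t, HasDerivAt g (g' t) t) (hb : ∀ t ≤ 0, |g' t| ≤ C * Real.exp (σ * t))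
    {s t : ℝ} (hst : s ≤ t) (ht : t ≤ 0) :
    |g t - g s| ≤ C / σ * (Real.exp (σ * t) - Real.exp (σ * s)) := by
  have he : ∀ t, HasDerivAt (fun t => C / σ * Real.exp (σ * t)) (C * Real.exp (σ * t)) t := by
    intro t
    have : HasDerivAt (fun t => Real.exp (σ * t)) (Real.exp (σ * t) * σ) t := by
      simpa using ((hasDerivAt_id t).const_mul σ).exp
    refine (this.const_mul (C / σ)).congr_deriv ?_
    field_simp
  have key : ∀ h h' : ℝ → ℝ, (∀ t, HasDerivAt h (h' t) t) → (∀ t ≤ 0, 0 ≤ h' t) → h s ≤ h t := by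
    intro h h' hd hn
    have : MonotoneOn h (Set.Iic 0) := by
      refine monotoneOn_of_deriv_nonneg (convex_Iic 0)
        (fun t _ => (hd t).continuousAt.continuousWithinAt)
        (fun t _ => (hd t).differentiableAt.differentiableWithinAt) fun t ht => ?_
      rw [(hd t).deriv]
      exact hn t (interior_subset (s := Set.Iic (0 : ℝ)) ht)
    exact this (hst.trans ht) ht hst
  have h1 := key _ _ (fun t => (he t).add (hg t)) fun t ht => by
    linarith [(abs_le.1 (hb t ht)).1]
  have h2 := key _ _ (fun t => (he t).sub (hg t)) fun t ht => by
    linarith [(abs_le.1 (hb t ht)).2]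
  simp only [Pi.add_apply, Pi.sub_apply] at h1 h2
  rw [abs_le]
  constructor <;> linarith

theorem JointlySmooth.hasDerivAt_spatialDeriv (hF : JointlySmooth F) (α : List (Fin 3)) (τ : ℝ)
    (x : E3) : HasDerivAt (fun s => _root_.spatialDeriv α (F s) x)
      (_root_.spatialDeriv α (_root_.timeDeriv F τ) x) τ := by
  rw [← hF.timeDeriv_spatialDeriv α τ]
  exact (hF.spatialDeriv α).hasDerivAt τ x

/-- Integration from `τ` up to `0`. For `σ < 0` the value at time `0` is harmless because `1 ≤
e^{στ}`. -/
theorem decay_of_timeDeriv_of_neg (hσ : σ < 0) (hF : JointlySmooth F) (hd : Decay σ (timeDeriv F))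
    (h0 : ∀ α, ∃ C, ∀ x, |spatialDeriv α (F 0) x| ≤ C) : Decay σ F := by
  intro α
  obtain ⟨C, hC⟩ := hd α
  obtain ⟨D, hD⟩ := h0 α
  refine ⟨D + |C / σ|, fun τ hτ x => ?_⟩
  have h1 := abs_sub_le_of_deriv_le_exp hσ.ne (fun t => hF.hasDerivAt_spatialDeriv α t x)
    (fun t ht => hC t ht x) hτ le_rfl
  have h2 : 1 ≤ Real.exp (σ * τ) := Real.one_le_exp (mul_nonneg_of_nonpos_of_nonpos hσ.le hτ)
  have h3 : |C / σ * (Real.exp (σ * 0) - Real.exp (σ * τ))| ≤ |C / σ| * Real.exp (σ * τ) := by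
    rw [abs_mul]
    refine mul_le_mul_of_nonneg_left ?_ (abs_nonneg _)
    rw [mul_zero, Real.exp_zero, abs_sub_comm, abs_of_nonneg (by linarith)]
    linarith
  have h4 := (h1.trans (le_abs_self _)).trans h3
  have h5 := hD x
  have h6 : |spatialDeriv α (F τ) x| ≤ |spatialDeriv α (F 0) x|
      + |spatialDeriv α (F 0) x - spatialDeriv α (F τ) x| := by
    have := abs_sub (spatialDeriv α (F 0) x) (spatialDeriv α (F 0) x - spatialDeriv α (F τ) x)
    rwa [sub_sub_cancel] at this
  have h7 : D ≤ D * Real.exp (σ * τ) :=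
    le_mul_of_one_le_right ((abs_nonneg _).trans h5) h2
  rw [add_mul]
  linarith

theorem Decay.bounded_zero (h : Decay σ F) (α : List (Fin 3)) :
    ∃ C, ∀ x, |_root_.spatialDeriv α (F 0) x| ≤ C := by
  obtain ⟨C, hC⟩ := h α
  exact ⟨C, fun x => by simpa using hC 0 le_rfl x⟩

theorem tendsto_exp_atBot_of_pos (hσ : 0 < σ) :
    Filter.Tendsto (fun τ => Real.exp (σ * τ)) Filter.atBot (nhds 0) :=
  Real.tendsto_exp_atBot.comp (Filter.tendsto_id.const_mul_atBot hσ)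

theorem Decay.tendsto_zero (hσ : 0 < σ) (h : Decay σ F) (x : E3) :
    Filter.Tendsto (fun τ => F τ x) Filter.atBot (nhds 0) := by
  obtain ⟨C, hC⟩ := h []
  refine squeeze_zero_norm' (a := fun τ => C * Real.exp (σ * τ)) ?_
    (by simpa using (tendsto_exp_atBot_of_pos hσ).const_mul C)
  filter_upwards [Filter.eventually_le_atBot 0] with τ hτ using hC τ hτ x

/-- A function with integrable time derivative that tends to zero decays. -/
theorem decay_of_timeDeriv_of_pos (hσ : 0 < σ) (hF : JointlySmooth F)
    (hd : Decay σ (timeDeriv F)) (hρ : 0 < ρ) (h0 : Decay ρ F) : Decay σ F := by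
  intro α
  obtain ⟨C, hC⟩ := hd α
  refine ⟨C / σ, fun τ hτ x => ?_⟩
  have h1 : Filter.Tendsto (fun s => |spatialDeriv α (F τ) x - spatialDeriv α (F s) x|)
      Filter.atBot (nhds |spatialDeriv α (F τ) x|) := by
    simpa using (((h0.spatialDeriv α).tendsto_zero hρ x).const_sub (spatialDeriv α (F τ) x)).abs
  have h2 : Filter.Tendsto (fun s => C / σ * (Real.exp (σ * τ) - Real.exp (σ * s)))
      Filter.atBot (nhds (C / σ * Real.exp (σ * τ))) := by
    simpa using ((tendsto_exp_atBot_of_pos hσ).const_sub (Real.exp (σ * τ))).const_mul (C / σ)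
  refine le_of_tendsto_of_tendsto h1 h2 ?_
  filter_upwards [Filter.eventually_le_atBot τ] with s hs
  exact abs_sub_le_of_deriv_le_exp hσ.ne' (fun t => hF.hasDerivAt_spatialDeriv α t x)
    (fun t ht => hC t ht x) hs hτ

theorem fderiv_eq_sum_proj (f : E3 → ℝ) (x : E3) :
    fderiv ℝ f x = ∑ i, partialDeriv i f x • (EuclideanSpace.proj i : E3 →L[ℝ] ℝ) := by
  ext v
  rw [fderiv_apply_eq_sum_partialDeriv]
  simp [mul_comm]

/-- The partial derivatives of each member are again members, so the order of differentiability can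
be raised for the whole family at once. -/
theorem contDiff_of_hasFDerivAt_family {G : List (Fin 3) → E3 → ℝ}
    (h : ∀ α x, HasFDerivAt (G α) (∑ i, G (i :: α) x • (EuclideanSpace.proj i : E3 →L[ℝ] ℝ)) x)
    (α : List (Fin 3)) : ContDiff ℝ ∞ (G α) := by
  rw [contDiff_infty]
  intro n
  induction n generalizing α with
  | zero =>
    exact contDiff_zero.2 (continuous_iff_continuousAt.2 fun x => (h α x).continuousAt)
  | succ n ih =>
    have hn : ((n + 1 : ℕ) : WithTop ℕ∞) = (n : WithTop ℕ∞) + 1 := by push_cast; rfl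
    rw [hn, contDiff_succ_iff_fderiv]
    refine ⟨fun x => (h α x).differentiableAt, by simp, ?_⟩
    have : fderiv ℝ (G α)
        = fun x => ∑ i, G (i :: α) x • (EuclideanSpace.proj i : E3 →L[ℝ] ℝ) :=
      funext fun x => (h α x).fderiv
    rw [this]
    exact ContDiff.sum fun i _ => (ih (i :: α)).smul contDiff_const

theorem spatialDeriv_of_hasFDerivAt_family {G : List (Fin 3) → E3 → ℝ}
    (h : ∀ α x, HasFDerivAt (G α) (∑ i, G (i :: α) x • (EuclideanSpace.proj i : E3 →L[ℝ] ℝ)) x)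
    (α : List (Fin 3)) : spatialDeriv α (G []) = G α := by
  induction α with
  | nil => rfl
  | cons i α ih =>
    rw [spatialDeriv_cons, ih]
    funext x
    simp only [partialDeriv]
    rw [(h α x).fderiv]
    simp

/-- A function with integrable time derivative has a smooth limit as `τ → -∞`. -/
theorem exists_limit_of_timeDeriv (hσ : 0 < σ) (hF : JointlySmooth F)
    (hd : Decay σ (timeDeriv F)) :
    ∃ G : E3 → ℝ, ContDiff ℝ ∞ G ∧ (∀ x, Filter.Tendsto (fun τ => F τ x) Filter.atBot (nhds (G x)))
      ∧ Decay σ fun τ x => F τ x - G x := by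
  choose C hC using hd
  have hdiff : ∀ α x s t, s ≤ t → t ≤ 0 → |spatialDeriv α (F t) x - spatialDeriv α (F s) x|
      ≤ C α / σ * (Real.exp (σ * t) - Real.exp (σ * s)) := fun α x s t hst ht =>
    abs_sub_le_of_deriv_le_exp hσ.ne' (fun t => hF.hasDerivAt_spatialDeriv α t x)
      (fun t ht => hC α t ht x) hst ht
  have hCn : ∀ α, 0 ≤ C α := fun α => by
    simpa using (abs_nonneg _).trans (hC α 0 le_rfl 0)
  have hdiff' : ∀ α x s t, s ≤ t → t ≤ 0 → |spatialDeriv α (F t) x - spatialDeriv α (F s) x|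
      ≤ C α / σ * Real.exp (σ * t) := fun α x s t hst ht =>
    (hdiff α x s t hst ht).trans (mul_le_mul_of_nonneg_left
      (by linarith [Real.exp_pos (σ * s)]) (div_nonneg (hCn α) hσ.le))
  -- The limit is taken along the times `-n`, where the exponential bound gives a Cauchy sequence;
  -- the bound then covers all `τ ≤ 0`.
  have hseq : Filter.Tendsto (fun n : ℕ => -(n : ℝ)) Filter.atTop Filter.atBot :=
    Filter.tendsto_neg_atTop_atBot.comp tendsto_natCast_atTop_atTop
  have hb : ∀ K, Filter.Tendsto (fun n : ℕ => K * Real.exp (σ * -(n : ℝ))) Filter.atTop (nhds 0) := by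
    intro K
    simpa using ((tendsto_exp_atBot_of_pos hσ).comp hseq).const_mul K
  have hlim : ∀ α x, ∃ l, Filter.Tendsto (fun n : ℕ => spatialDeriv α (F (-(n : ℝ))) x)
      Filter.atTop (nhds l) := by
    intro α x
    refine cauchySeq_tendsto_of_complete (cauchySeq_of_le_tendsto_0'
      (fun n : ℕ => C α / σ * Real.exp (σ * -(n : ℝ))) (fun n m hnm => ?_) (hb _))
    exact hdiff' α x _ _ (by simpa using hnm) (by simp)
  choose G hG using hlim
  have hGb : ∀ α, ∀ t ≤ 0, ∀ x, |spatialDeriv α (F t) x - G α x| ≤ C α / σ * Real.exp (σ * t) := by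
    intro α t ht x
    refine le_of_tendsto ((hG α x).const_sub _).abs ?_
    filter_upwards [hseq.eventually (Filter.eventually_le_atBot t)] with n hn
    exact hdiff' α x _ _ hn ht
  -- All spatial derivatives converge uniformly, so the limits `G α` are the derivatives of one
  -- another.
  have hfam : ∀ α x, HasFDerivAt (G α)
      (∑ i, G (i :: α) x • (EuclideanSpace.proj i : E3 →L[ℝ] ℝ)) x := by
    intro α
    refine hasFDerivAt_of_tendstoUniformly (l := Filter.atTop)
      (f := fun (n : ℕ) => spatialDeriv α (F (-(n : ℝ))))
      (f' := fun n => fderiv ℝ (spatialDeriv α (F (-(n : ℝ))))) ?_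
      (fun n x => ((spatialDeriv_smooth (hF.space _) α).differentiable (by simp) x).hasFDerivAt)
      (hG α)
    rw [Metric.tendstoUniformly_iff]
    intro ε hε
    filter_upwards [(hb (∑ i, C (i :: α) / σ * ‖(EuclideanSpace.proj i : E3 →L[ℝ] ℝ)‖)).eventually
      (gt_mem_nhds hε)] with n hn x
    refine lt_of_le_of_lt ?_ hn
    rw [dist_comm, dist_eq_norm, fderiv_eq_sum_proj, ← Finset.sum_sub_distrib, Finset.sum_mul]
    refine (norm_sum_le _ _).trans (Finset.sum_le_sum fun i _ => ?_)
    rw [← sub_smul, norm_smul, mul_right_comm]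
    exact mul_le_mul_of_nonneg_right (hGb (i :: α) _ (by simp) x) (norm_nonneg _)
  have hsm := contDiff_of_hasFDerivAt_family hfam []
  have hdec : Decay σ fun τ x => F τ x - G [] x := by
    intro α
    refine ⟨C α / σ, fun τ hτ x => ?_⟩
    rw [spatialDeriv_sub (hF.space τ) hsm, spatialDeriv_of_hasFDerivAt_family hfam]
    exact hGb α τ hτ x
  refine ⟨G [], hsm, fun x => ?_, hdec⟩
  simpa using (hdec.tendsto_zero hσ x).add_const (G [] x)

end Decay

/-! ### From bounds in mean to uniform bounds. -/

section Sobolev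

variable {F : ℝ → E3 → ℝ}

/-- Removes the innermost average at the price of one more spatial derivative; `T` stands for the
averages that remain. The price is affordable because the hypothesis covers all derivatives. -/
theorem bound_of_lineAvg_bound (T : C(E3, ℝ) →ₗ[ℝ] C(E3, ℝ)) (hT : Monotone T) (b : E3)
    (hF : JointlySmooth F) {γ : ℝ → ℝ}
    (h : ∀ α, ∃ C, ∀ τ ≤ 0, ∀ x,
      T (lineAvg b |slice (fun τ => spatialDeriv α (F τ)) (hF.spatialDeriv α).continuous τ|) x
        ≤ C * γ τ) (α : List (Fin 3)) :
    ∃ C, ∀ τ ≤ 0, ∀ x,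
      T |slice (fun τ => spatialDeriv α (F τ)) (hF.spatialDeriv α).continuous τ| x ≤ C * γ τ := by
  choose C hC using h
  refine ⟨C α + ∑ i, |b i| * C (i :: α), fun τ hτ x => ?_⟩
  have hs := spatialDeriv_smooth (hF.space τ) α
  have h1 : |dirDeriv b hs| ≤ ∑ i, |b i| •
      |slice (fun τ => spatialDeriv (i :: α) (F τ)) (hF.spatialDeriv (i :: α)).continuous τ| := by
    intro y
    have : |fderiv ℝ (spatialDeriv α (F τ)) y b|
        ≤ ∑ i, |b i| * |partialDeriv i (spatialDeriv α (F τ)) y| := by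
      rw [fderiv_apply_eq_sum_partialDeriv]
      refine (Finset.abs_sum_le_sum_abs _ _).trans (le_of_eq ?_)
      simp only [abs_mul]
    change |fderiv ℝ (spatialDeriv α (F τ)) y b| ≤ _
    refine this.trans (le_of_eq ?_)
    change _ = (∑ i, |b i| • |slice (fun τ => spatialDeriv (i :: α) (F τ))
      (hF.spatialDeriv (i :: α)).continuous τ| : C(E3, ℝ)) y
    rw [ContinuousMap.sum_apply]
    rfl
  have h2 := (abs_le_lineAvg b hs).trans (add_le_add_right (lineAvg_monotone b h1) _)
  have h3 := hT h2 x
  refine h3.trans ?_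
  change T _ x ≤ _
  rw [map_add, map_sum, map_sum, ContinuousMap.add_apply, ContinuousMap.sum_apply, add_mul,
    Finset.sum_mul]
  refine add_le_add (hC α τ hτ x) (Finset.sum_le_sum fun i _ => ?_)
  rw [map_smul, map_smul, mul_assoc]
  exact mul_le_mul_of_nonneg_left (hC (i :: α) τ hτ x) (abs_nonneg _)

/-- The embedding of `W^{3,1}` into `L^∞`, one direction at a time: the three averages are stripped
off from the inside out. -/
theorem decay_of_boxAvg_bound (b : Fin 3 → E3) (hF : JointlySmooth F) {σ : ℝ}
    (h : ∀ α, ∃ C, ∀ τ ≤ 0, ∀ x,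
      boxAvg b |slice (fun τ => spatialDeriv α (F τ)) (hF.spatialDeriv α).continuous τ| x
        ≤ C * Real.exp (σ * τ)) : Decay σ F :=
  bound_of_lineAvg_bound LinearMap.id monotone_id (b 0) hF
    (bound_of_lineAvg_bound (lineAvg (b 0)) (lineAvg_monotone _) (b 1) hF
      (bound_of_lineAvg_bound (lineAvg (b 0) ∘ₗ lineAvg (b 1))
        ((lineAvg_monotone _).comp (lineAvg_monotone _)) (b 2) hF h))

theorem exists_basis_mem (L : Submodule ℤ E3) [DiscreteTopology L] [IsZLattice ℝ L] :
    ∃ b : Module.Basis (Fin 3) ℝ E3, ∀ j, b j ∈ L := by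
  have h : Module.finrank ℤ L = 3 := by
    rw [ZLattice.rank ℝ L]; simp
  let b := (Module.finBasisOfFinrankEq ℤ L h).ofZLatticeBasis ℝ L
  refine ⟨b, fun j => ?_⟩
  rw [Module.Basis.ofZLatticeBasis_apply]
  exact Subtype.property _

/-- A solution of the homogeneous equation grows at most like `e^{-2 ν τ}`. -/
theorem decay_of_solvesWave {L : Submodule ℤ E3} [DiscreteTopology L] [IsZLattice ℝ L] {ν w : ℝ}
    {u : ℝ → E3 → ℝ} (hν : 0 < ν) (hw : 0 ≤ w) (hu : JointlySmooth u)
    (hp : ∀ τ, LatticePeriodic L (u τ)) (hs : SolvesWave ν w (fun _ _ => 0) u) :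
    Decay (-2 * ν) (timeDeriv u) ∧ Decay (-2 * ν) u := by
  obtain ⟨b, hb⟩ := exists_basis_mem L
  have h1 : Decay (-2 * ν) (timeDeriv u) := by
    refine decay_of_boxAvg_bound b hu.timeDeriv fun α => ?_
    have hs' : SolvesWave ν w (fun _ _ => 0) fun τ => spatialDeriv α (u τ) := by
      have := hs.spatialDeriv hu (jointlySmooth_of_space contDiff_const) α
      simpa only [spatialDeriv_zero] using this
    obtain ⟨C, hC⟩ := boxAvg_abs_timeDeriv_le b hb hν.le hw (hu.spatialDeriv α)
      (fun τ => spatialDeriv_periodic (hp τ) α) hs'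
    refine ⟨C, fun τ hτ x => ?_⟩
    have he : slice (fun τ => spatialDeriv α (timeDeriv u τ))
        (hu.timeDeriv.spatialDeriv α).continuous τ
        = slice (timeDeriv fun τ => spatialDeriv α (u τ))
          (hu.spatialDeriv α).timeDeriv.continuous τ := by
      ext y
      exact (congrFun (hu.timeDeriv_spatialDeriv α τ) y).symm
    rw [he]
    exact hC τ hτ x
  exact ⟨h1, decay_of_timeDeriv_of_neg (by linarith) hu h1 fun α =>
    exists_bound_of_periodic (spatialDeriv_smooth (hu.space 0) α).continuous
      (spatialDeriv_periodic (hp 0) α)⟩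

end Sobolev

/-! ### The integrating factor and the gain of two in the exponent. -/

section Gain

variable {ν w σ m δ : ℝ} {u r h k v : ℝ → E3 → ℝ}

theorem SolvesWave.add (hu : SolvesWave ν w h u) (hv : SolvesWave ν w k v) (hus : JointlySmooth u)
    (hvs : JointlySmooth v) :
    SolvesWave ν w (fun τ x => h τ x + k τ x) fun τ x => u τ x + v τ x := by
  intro τ x
  rw [timeDeriv_add hus hvs, timeDeriv_add hus.timeDeriv hvs.timeDeriv,
    lap_add (hus.space τ) (hvs.space τ)]
  linear_combination hu τ x + hv τ x

theorem SolvesWave.sub (hu : SolvesWave ν w h u) (hv : SolvesWave ν w k v) (hus : JointlySmooth u)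
    (hvs : JointlySmooth v) :
    SolvesWave ν w (fun τ x => h τ x - k τ x) fun τ x => u τ x - v τ x := by
  intro τ x
  rw [timeDeriv_sub hus hvs, timeDeriv_sub hus.timeDeriv hvs.timeDeriv,
    lap_sub (hus.space τ) (hvs.space τ)]
  linear_combination hu τ x - hv τ x

theorem Decay.exp_mul {F : ℝ → E3 → ℝ} (hF : Decay σ F) (hFs : JointlySmooth F) (a c : ℝ) :
    Decay (a + σ) fun τ x => c * Real.exp (a * τ) * F τ x :=
  hF.time_mul (A := |c|) (fun τ _ => by rw [abs_mul, Real.abs_exp]) hFs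

theorem JointlySmooth.exp_mul {F : ℝ → E3 → ℝ} (hF : JointlySmooth F) (a c : ℝ) :
    JointlySmooth fun τ x => c * Real.exp (a * τ) * F τ x :=
  (jointlySmooth_of_time (by fun_prop)).mul hF

/-- The factor `e^{2ντ}` turns `r'' + 2νr'` into an exact derivative. The leading `1 *` matches the
shape `c * Real.exp (a * τ)` of `Decay.exp_mul`. -/
theorem SolvesWave.timeDeriv_integrating_factor (hs : SolvesWave ν w h r) (hr : JointlySmooth r) :
    timeDeriv (fun τ x => 1 * Real.exp (2 * ν * τ) * timeDeriv r τ x)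
      = fun τ x => 1 * Real.exp (2 * ν * τ) * (w * Real.exp (2 * τ) * lap (r τ) x + h τ x) := by
  funext τ x
  have he : HasDerivAt (fun s : ℝ => 1 * Real.exp (2 * ν * s))
      (1 * (Real.exp (2 * ν * τ) * (2 * ν))) τ := by
    simpa using ((hasDerivAt_id τ).const_mul (2 * ν)).exp
  refine (he.mul (hr.timeDeriv.hasDerivAt τ x)).deriv.trans ?_
  linear_combination Real.exp (2 * ν * τ) * hs τ x

theorem SolvesWave.decay_source (hs : SolvesWave ν w h r) (hr : JointlySmooth r)
    (hh : JointlySmooth h) (hσ : Decay σ r) (hm : Decay m h) (hmσ : m ≤ σ + 2) :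
    Decay (2 * ν + m)
      (timeDeriv fun τ x => 1 * Real.exp (2 * ν * τ) * timeDeriv r τ x) := by
  rw [hs.timeDeriv_integrating_factor hr]
  have h1 : Decay m fun τ x => w * Real.exp (2 * τ) * lap (r τ) x :=
    ((hσ.lap hr).exp_mul hr.lap 2 w).mono (by linarith)
  exact (h1.add hm (hr.lap.exp_mul 2 w) hh).exp_mul ((hr.lap.exp_mul 2 w).add hh) (2 * ν) 1

/-- The quantity `e^{2ντ}r'` has a decaying derivative and, thanks to `h0` with `δ > 0`, tends to
zero. So the mode `e^{-2ντ}` is absent and one may integrate from `-∞`. -/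
theorem SolvesWave.decay_timeDeriv (hs : SolvesWave ν w h r) (hr : JointlySmooth r)
    (hh : JointlySmooth h) (hδ : 0 < δ) (h0 : Decay (δ - 2 * ν) (timeDeriv r)) (hσ : Decay σ r)
    (hm : Decay m h) (hmσ : m ≤ σ + 2) (hνm : 0 < 2 * ν + m) : Decay m (timeDeriv r) := by
  have hg : Decay (2 * ν + m) fun τ x => 1 * Real.exp (2 * ν * τ) * timeDeriv r τ x :=
    decay_of_timeDeriv_of_pos hνm (hr.timeDeriv.exp_mul _ _)
      (hs.decay_source hr hh hσ hm hmσ) hδ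
      ((h0.exp_mul hr.timeDeriv (2 * ν) 1).mono (by linarith))
  have h1 : timeDeriv r = fun τ x => 1 * Real.exp (-(2 * ν) * τ)
      * (1 * Real.exp (2 * ν * τ) * timeDeriv r τ x) := by
    funext τ x
    have : Real.exp (-(2 * ν) * τ) * Real.exp (2 * ν * τ) = 1 := by
      rw [← Real.exp_add]; simp
    linear_combination -timeDeriv r τ x * this
  rw [h1]
  exact (hg.exp_mul (hr.timeDeriv.exp_mul _ _) _ _).mono (by linarith)

end Gain

/-! ### The two formal solutions. -/

section Terms

/-- Smoothness together with decay of the function and of its time derivative. -/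
structure DecayC1 (σ : ℝ) (F : ℝ → E3 → ℝ) : Prop where
  smooth : JointlySmooth F
  decay : Decay σ F
  decay_timeDeriv : Decay σ (timeDeriv F)

variable {σ ρ : ℝ} {F G : ℝ → E3 → ℝ}

theorem DecayC1.mono (h : DecayC1 σ F) (hρ : ρ ≤ σ) : DecayC1 ρ F :=
  ⟨h.smooth, h.decay.mono hρ, h.decay_timeDeriv.mono hρ⟩

theorem DecayC1.add (hF : DecayC1 σ F) (hG : DecayC1 σ G) :
    DecayC1 σ fun τ x => F τ x + G τ x :=
  ⟨hF.smooth.add hG.smooth, hF.decay.add hG.decay hF.smooth hG.smooth, by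
    rw [timeDeriv_add hF.smooth hG.smooth]
    exact hF.decay_timeDeriv.add hG.decay_timeDeriv hF.smooth.timeDeriv hG.smooth.timeDeriv⟩

theorem DecayC1.sub (hF : DecayC1 σ F) (hG : DecayC1 σ G) :
    DecayC1 σ fun τ x => F τ x - G τ x :=
  ⟨hF.smooth.sub hG.smooth, hF.decay.sub hG.decay hF.smooth hG.smooth, by
    rw [timeDeriv_sub hF.smooth hG.smooth]
    exact hF.decay_timeDeriv.sub hG.decay_timeDeriv hF.smooth.timeDeriv hG.smooth.timeDeriv⟩

theorem decayC1_zero : DecayC1 σ fun _ _ => 0 :=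
  ⟨jointlySmooth_of_space contDiff_const, decay_zero, by
    have : timeDeriv (fun (_ : ℝ) (_ : E3) => (0 : ℝ)) = fun _ _ => 0 := by
      funext τ x; simp [timeDeriv]
    rw [this]; exact decay_zero⟩

theorem DecayC1.sum {F : ℕ → ℝ → E3 → ℝ} (n : ℕ) (hF : ∀ i, DecayC1 σ (F i)) :
    DecayC1 σ fun τ x => ∑ i ∈ Finset.range n, F i τ x := by
  induction n with
  | zero => simpa using decayC1_zero
  | succ n ih =>
    simp only [Finset.sum_range_succ]
    exact ih.add (hF n)

/-- Smooth functions on the torus. -/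
def TorusSmooth (L : Submodule ℤ E3) (f : E3 → ℝ) : Prop := ContDiff ℝ ∞ f ∧ LatticePeriodic L f

variable {L : Submodule ℤ E3} {f : E3 → ℝ}

theorem TorusSmooth.lap_iterate (hf : TorusSmooth L f) (j : ℕ) : TorusSmooth L (lap^[j] f) :=
  ⟨lap_iterate_smooth hf.1 j, lap_iterate_periodic hf.2 j⟩

theorem TorusSmooth.decay [DiscreteTopology L] [IsZLattice ℝ L] (hf : TorusSmooth L f) :
    Decay 0 fun _ => f := by
  intro α
  obtain ⟨C, hC⟩ := exists_bound_of_periodic (spatialDeriv_smooth hf.1 α).continuous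
    (spatialDeriv_periodic hf.2 α)
  exact ⟨C, fun τ _ x => by simpa using hC x⟩

/-- The function `(a + b τ) e^{k τ} f`. -/
noncomputable def logTerm (a b k : ℝ) (f : E3 → ℝ) : ℝ → E3 → ℝ :=
  fun τ x => (a + b * τ) * Real.exp (k * τ) * f x

theorem logTerm_smooth (a b k : ℝ) (hf : ContDiff ℝ ∞ f) : JointlySmooth (logTerm a b k f) :=
  (jointlySmooth_of_time (by fun_prop)).mul (jointlySmooth_of_space hf)

theorem timeDeriv_logTerm (a b k : ℝ) (f : E3 → ℝ) :
    timeDeriv (logTerm a b k f) = logTerm (b + k * a) (k * b) k f := by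
  funext τ x
  have h1 : HasDerivAt (fun s : ℝ => Real.exp (k * s)) (Real.exp (k * τ) * k) τ := by
    simpa using ((hasDerivAt_id τ).const_mul k).exp
  have h2 : HasDerivAt (fun s : ℝ => a + b * s) b τ := by
    simpa using ((hasDerivAt_id τ).const_mul b).const_add a
  refine ((h2.mul h1).mul_const (f x)).deriv.trans ?_
  simp only [logTerm]
  ring

theorem lap_logTerm (a b k : ℝ) (hf : ContDiff ℝ ∞ f) (τ : ℝ) :
    lap (logTerm a b k f τ) = logTerm a b k (lap f) τ :=
  lap_const_mul hf _

theorem logTerm_decay [DiscreteTopology L] [IsZLattice ℝ L] (hf : TorusSmooth L f) (a b : ℝ)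
    {k : ℝ} (hσ : σ < k) : Decay σ (logTerm a b k f) := by
  have h : ∀ τ ≤ 0, |(a + b * τ) * Real.exp (k * τ)|
      ≤ (|a| + |b| / (k - σ)) * Real.exp (σ * τ) := by
    intro τ hτ
    have hs : 0 < k - σ := by linarith
    have h1 : Real.exp (k * τ) = Real.exp ((k - σ) * τ) * Real.exp (σ * τ) := by
      rw [← Real.exp_add]; ring_nf
    have h2 : Real.exp ((k - σ) * τ) ≤ 1 :=
      Real.exp_le_one_iff.2 (mul_nonpos_of_nonneg_of_nonpos hs.le hτ)
    -- The factor `τ` is absorbed by the strict loss `k - σ` of exponent, using `1 + y ≤ e^y`.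
    have h3 : |τ| * Real.exp ((k - σ) * τ) ≤ 1 / (k - σ) := by
      have h4 := Real.add_one_le_exp (-((k - σ) * τ))
      have h5 : Real.exp (-((k - σ) * τ)) * Real.exp ((k - σ) * τ) = 1 := by
        rw [← Real.exp_add]; simp
      rw [le_div_iff₀ hs, abs_of_nonpos hτ]
      nlinarith [Real.exp_pos ((k - σ) * τ)]
    rw [abs_mul, Real.abs_exp, h1, ← mul_assoc]
    refine mul_le_mul_of_nonneg_right ?_ (Real.exp_nonneg _)
    have h6 : |a + b * τ| ≤ |a| + |b| * |τ| := (abs_add_le _ _).trans (by rw [abs_mul])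
    have h7 : |b| * (|τ| * Real.exp ((k - σ) * τ)) ≤ |b| * (1 / (k - σ)) :=
      mul_le_mul_of_nonneg_left h3 (abs_nonneg _)
    calc |a + b * τ| * Real.exp ((k - σ) * τ)
        ≤ (|a| + |b| * |τ|) * Real.exp ((k - σ) * τ) :=
          mul_le_mul_of_nonneg_right h6 (Real.exp_nonneg _)
      _ = |a| * Real.exp ((k - σ) * τ) + |b| * (|τ| * Real.exp ((k - σ) * τ)) := by ring
      _ ≤ |a| * 1 + |b| * (1 / (k - σ)) :=
          add_le_add (mul_le_mul_of_nonneg_left h2 (abs_nonneg _)) h7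
      _ = _ := by ring
  have := hf.decay.time_mul h (jointlySmooth_of_space hf.1)
  rw [add_zero] at this
  exact this

theorem logTerm_decayC1 [DiscreteTopology L] [IsZLattice ℝ L] (hf : TorusSmooth L f) (a b : ℝ)
    {k : ℝ} (hσ : σ < k) : DecayC1 σ (logTerm a b k f) :=
  ⟨logTerm_smooth _ _ _ hf.1, logTerm_decay hf a b hσ, by
    rw [timeDeriv_logTerm]; exact logTerm_decay hf _ _ hσ⟩

/-- The coefficients `a`, `b` of `(a + b τ) e^{k τ} Δ^j B`, `k = -2 ν + 2 j`, in the formal solution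
of the wave equation that starts with `e^{-2 ν τ} B`. -/
noncomputable def singularCoef (ν w : ℝ) : ℕ → ℝ × ℝ
  | 0 => (1, 0)
  | j + 1 =>
    -- Resonance at exponent `0`: the factor `2j(2j - 2ν)` vanishes for the new index, so the
    -- logarithmic coefficient has to satisfy `2νb = wa`. The other coefficient is free; taking it
    -- to be `0` leaves the constant mode entirely to `A`.
    if ((j + 1 : ℕ) : ℝ) = ν then (0, w * (singularCoef ν w j).1 / (2 * ν))
    else
      ((w * (singularCoef ν w j).1 - (4 * ((j + 1 : ℕ) : ℝ) - 2 * ν)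
          * (w * (singularCoef ν w j).2 / (2 * ((j + 1 : ℕ) : ℝ) * (2 * ((j + 1 : ℕ) : ℝ) - 2 * ν))))
          / (2 * ((j + 1 : ℕ) : ℝ) * (2 * ((j + 1 : ℕ) : ℝ) - 2 * ν)),
        w * (singularCoef ν w j).2 / (2 * ((j + 1 : ℕ) : ℝ) * (2 * ((j + 1 : ℕ) : ℝ) - 2 * ν)))

/-- The coefficients of `e^{2 j τ} Δ^j A` in the formal solution that starts with `A`. -/
noncomputable def regularCoef (ν w : ℝ) : ℕ → ℝ
  | 0 => 1
  | j + 1 => w * regularCoef ν w j / (2 * ((j + 1 : ℕ) : ℝ) * (2 * ((j + 1 : ℕ) : ℝ) + 2 * ν))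

variable {ν w : ℝ}

/-- A logarithm is created only at the resonant index and afterwards only passed on. -/
theorem exists_nat_of_singularCoef_snd_ne_zero {j : ℕ} (h : (singularCoef ν w j).2 ≠ 0) :
    ∃ n : ℕ, ν = n ∧ n ≤ j := by
  induction j with
  | zero => exact absurd rfl h
  | succ j ih =>
    by_cases hj : ((j + 1 : ℕ) : ℝ) = ν
    · exact ⟨j + 1, hj.symm, le_rfl⟩
    · rw [singularCoef, if_neg hj] at h
      have : (singularCoef ν w j).2 ≠ 0 := fun h0 => h (by simp [h0])
      obtain ⟨n, hn, hnj⟩ := ih this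
      exact ⟨n, hn, hnj.trans j.le_succ⟩

theorem singularCoef_fst_eq_zero (hν : 0 < ν) {j : ℕ} (h : (j : ℝ) = ν) :
    (singularCoef ν w j).1 = 0 := by
  cases j with
  | zero => simp at h; exact absurd h hν.ne
  | succ j => rw [singularCoef, if_pos h]

theorem singularCoef_snd_succ (j : ℕ) :
    2 * ((j + 1 : ℕ) : ℝ) * (2 * ((j + 1 : ℕ) : ℝ) - 2 * ν) * (singularCoef ν w (j + 1)).2
      = w * (singularCoef ν w j).2 := by
  by_cases hj : ((j + 1 : ℕ) : ℝ) = ν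
  · have h0 : (singularCoef ν w j).2 = 0 := by
      by_contra h
      obtain ⟨n, hn, hnj⟩ := exists_nat_of_singularCoef_snd_ne_zero h
      rw [hn] at hj
      have : j + 1 = n := by exact_mod_cast hj
      omega
    rw [h0, hj]; ring
  · rw [singularCoef, if_neg hj]
    have h1 : 2 * ((j + 1 : ℕ) : ℝ) * (2 * ((j + 1 : ℕ) : ℝ) - 2 * ν) ≠ 0 :=
      mul_ne_zero (by positivity) fun h => hj (by linarith)
    exact mul_div_cancel₀ _ h1

theorem singularCoef_fst_succ (hν : 0 < ν) (j : ℕ) :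
    2 * ((j + 1 : ℕ) : ℝ) * (2 * ((j + 1 : ℕ) : ℝ) - 2 * ν) * (singularCoef ν w (j + 1)).1
      = w * (singularCoef ν w j).1
        - (4 * ((j + 1 : ℕ) : ℝ) - 2 * ν) * (singularCoef ν w (j + 1)).2 := by
  by_cases hj : ((j + 1 : ℕ) : ℝ) = ν
  · rw [singularCoef, if_pos hj, hj]
    field_simp
    ring
  · rw [singularCoef, if_neg hj]
    have h1 : 2 * ((j + 1 : ℕ) : ℝ) * (2 * ((j + 1 : ℕ) : ℝ) - 2 * ν) ≠ 0 :=
      mul_ne_zero (by positivity) fun h => hj (by linarith)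
    exact mul_div_cancel₀ _ h1

theorem regularCoef_succ (hν : 0 < ν) (j : ℕ) :
    2 * ((j + 1 : ℕ) : ℝ) * (2 * ((j + 1 : ℕ) : ℝ) + 2 * ν) * regularCoef ν w (j + 1)
      = w * regularCoef ν w j := by
  rw [regularCoef]
  exact mul_div_cancel₀ _ (by positivity)

/-- The terms of the formal solution that starts with `e^{-2 ν τ} B`. -/
noncomputable def singularTerm (ν w : ℝ) (B : E3 → ℝ) (j : ℕ) : ℝ → E3 → ℝ :=
  logTerm (singularCoef ν w j).1 (singularCoef ν w j).2 (-2 * ν + 2 * j) (lap^[j] B)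

/-- The terms of the formal solution that starts with `A`. -/
noncomputable def regularTerm (ν w : ℝ) (A : E3 → ℝ) (j : ℕ) : ℝ → E3 → ℝ :=
  logTerm (regularCoef ν w j) 0 (2 * j) (lap^[j] A)

/-- A telescoping sum: each term solves the equation forced by its predecessor, so only the forcing
that the last term would exert on the next is left over. -/
theorem solvesWave_partialSum {U : ℕ → ℝ → E3 → ℝ} (hU : ∀ j, JointlySmooth (U j))
    (h0 : ∀ τ x, timeDeriv (timeDeriv (U 0)) τ x + 2 * ν * timeDeriv (U 0) τ x = 0)
    (h : ∀ j τ x, timeDeriv (timeDeriv (U (j + 1))) τ x + 2 * ν * timeDeriv (U (j + 1)) τ x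
      = w * Real.exp (2 * τ) * lap (U j τ) x) (J : ℕ) :
    SolvesWave ν w (fun τ x => -w * Real.exp (2 * τ) * lap (U J τ) x)
      fun τ x => ∑ j ∈ Finset.range (J + 1), U j τ x := by
  induction J with
  | zero =>
    intro τ x
    simp only [zero_add, Finset.sum_range_one]
    linear_combination h0 τ x
  | succ J ih =>
    have h1 : SolvesWave ν w (fun τ x => w * Real.exp (2 * τ) * lap (U J τ) x
        - w * Real.exp (2 * τ) * lap (U (J + 1) τ) x) (U (J + 1)) := by
      intro τ x
      linear_combination h J τ x
    have h2 := ih.add h1 (JointlySmooth.sum hU) (hU (J + 1))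
    intro τ x
    have h3 := h2 τ x
    simp only [← Finset.sum_range_succ (fun j => U j _ _) (J + 1)] at h3
    refine h3.trans ?_
    ring

/-- The coefficients of `1` and of `τ` on the right are the source of the two recursion relations.
-/
theorem logTerm_wave (a b k : ℝ) (f : E3 → ℝ) (τ : ℝ) (x : E3) :
    timeDeriv (timeDeriv (logTerm a b k f)) τ x + 2 * ν * timeDeriv (logTerm a b k f) τ x
      = (k * (k + 2 * ν) * a + (2 * k + 2 * ν) * b + k * (k + 2 * ν) * b * τ)
        * Real.exp (k * τ) * f x := by
  simp only [timeDeriv_logTerm]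
  simp only [logTerm]
  ring

theorem singularTerm_solvesWave (hν : 0 < ν) {B : E3 → ℝ} (hB : ContDiff ℝ ∞ B) (J : ℕ) :
    SolvesWave ν w (fun τ x => -w * Real.exp (2 * τ) * lap (singularTerm ν w B J τ) x)
      fun τ x => ∑ j ∈ Finset.range (J + 1), singularTerm ν w B j τ x := by
  refine solvesWave_partialSum (U := singularTerm ν w B)
    (fun j => logTerm_smooth _ _ _ (lap_iterate_smooth hB j)) ?_ ?_ J
  · intro τ x
    simp only [singularTerm]
    rw [logTerm_wave]
    simp [singularCoef]
  · intro j τ x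
    simp only [singularTerm]
    rw [logTerm_wave, lap_logTerm _ _ _ (lap_iterate_smooth hB j),
      Function.iterate_succ_apply', logTerm]
    have h1 := singularCoef_fst_succ (w := w) hν j
    have h2 := singularCoef_snd_succ (ν := ν) (w := w) j
    have he : Real.exp ((-2 * ν + 2 * ((j + 1 : ℕ) : ℝ)) * τ)
        = Real.exp (2 * τ) * Real.exp ((-2 * ν + 2 * (j : ℝ)) * τ) := by
      rw [← Real.exp_add]; push_cast; ring_nf
    rw [he]
    linear_combination (Real.exp (2 * τ) * Real.exp ((-2 * ν + 2 * (j : ℝ)) * τ)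
      * lap (lap^[j] B) x) * (h1 + τ * h2)

theorem regularTerm_solvesWave (hν : 0 < ν) {A : E3 → ℝ} (hA : ContDiff ℝ ∞ A) (J : ℕ) :
    SolvesWave ν w (fun τ x => -w * Real.exp (2 * τ) * lap (regularTerm ν w A J τ) x)
      fun τ x => ∑ j ∈ Finset.range (J + 1), regularTerm ν w A j τ x := by
  refine solvesWave_partialSum (U := regularTerm ν w A)
    (fun j => logTerm_smooth _ _ _ (lap_iterate_smooth hA j)) ?_ ?_ J
  · intro τ x
    simp only [regularTerm]
    rw [logTerm_wave]
    simp
  · intro j τ x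
    simp only [regularTerm]
    rw [logTerm_wave, lap_logTerm _ _ _ (lap_iterate_smooth hA j),
      Function.iterate_succ_apply', logTerm]
    have h1 := regularCoef_succ (w := w) hν j
    have he : Real.exp ((2 * ((j + 1 : ℕ) : ℝ)) * τ)
        = Real.exp (2 * τ) * Real.exp ((2 * (j : ℝ)) * τ) := by
      rw [← Real.exp_add]; push_cast; ring_nf
    rw [he]
    linear_combination (Real.exp (2 * τ) * Real.exp ((2 * (j : ℝ)) * τ)
      * lap (lap^[j] A) x) * h1

end Terms

/-! ### Extraction of the data and estimate of the remainder. -/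

section Expansion

variable {L : Submodule ℤ E3} {ν w : ℝ} {u : ℝ → E3 → ℝ}

theorem periodic_of_tendsto {F : ℝ → E3 → ℝ} {G : E3 → ℝ} (hp : ∀ τ, LatticePeriodic L (F τ))
    (h : ∀ x, Filter.Tendsto (fun τ => F τ x) Filter.atBot (nhds (G x))) : LatticePeriodic L G := by
  intro v hv x
  refine tendsto_nhds_unique (h (x + v)) ?_
  simp only [hp _ v hv x]
  exact h x

variable [DiscreteTopology L] [IsZLattice ℝ L]

theorem singularTerm_decayC1 {B : E3 → ℝ} (hB : TorusSmooth L B) (j : ℕ) {σ : ℝ}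
    (hσ : σ < -2 * ν + 2 * j) : DecayC1 σ (singularTerm ν w B j) :=
  logTerm_decayC1 (hB.lap_iterate j) _ _ hσ

theorem regularTerm_decayC1 {A : E3 → ℝ} (hA : TorusSmooth L A) (j : ℕ) {σ : ℝ}
    (hσ : σ < 2 * j) : DecayC1 σ (regularTerm ν w A j) :=
  logTerm_decayC1 (hA.lap_iterate j) _ _ hσ

/-- The leading singular coefficient. -/
theorem exists_singular_data (hν : 1 ≤ ν) (hw : 0 ≤ w) (hu : JointlySmooth u)
    (hp : ∀ τ, LatticePeriodic L (u τ)) (hs : SolvesWave ν w (fun _ _ => 0) u) :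
    ∃ B, TorusSmooth L B ∧ DecayC1 (1 - 2 * ν) fun τ x => u τ x - singularTerm ν w B 0 τ x := by
  obtain ⟨hd, h0⟩ := decay_of_solvesWave (by linarith) hw hu hp hs
  have hsrc := hs.decay_source (m := 2 - 2 * ν) hu (jointlySmooth_of_space contDiff_const) h0
    decay_zero (by linarith)
  obtain ⟨G, hGs, hGt, hGd⟩ := exists_limit_of_timeDeriv (σ := 2 * ν + (2 - 2 * ν)) (by linarith)
    (hu.timeDeriv.exp_mul (2 * ν) 1) hsrc
  have hGp : LatticePeriodic L G := periodic_of_tendsto (fun τ v hv x => by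
    rw [timeDeriv_periodic hp τ v hv x]) hGt
  have hν0 : ν ≠ 0 := by linarith
  -- The time derivative of `e^{-2ντ}B` is `-2νe^{-2ντ}B`, which has to match `e^{-2ντ}G`.
  have hB : TorusSmooth L fun x => -1 / (2 * ν) * G x :=
    ⟨contDiff_const.mul hGs, fun v hv x => by simp only [hGp v hv x]⟩
  refine ⟨_, hB, ?_⟩
  set B : E3 → ℝ := fun x => -1 / (2 * ν) * G x with hBdef
  have h1 := singularTerm_decayC1 (ν := ν) (w := w) hB 0 (σ := -2 * ν - 1) (by simp)
  have hder : timeDeriv (fun τ x => u τ x - singularTerm ν w B 0 τ x)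
      = fun τ x => 1 * Real.exp (-(2 * ν) * τ) *
        (1 * Real.exp (2 * ν * τ) * timeDeriv u τ x - G x) := by
    rw [timeDeriv_sub hu h1.smooth]
    funext τ x
    have h2 : timeDeriv (singularTerm ν w B 0) τ x = Real.exp (-(2 * ν) * τ) * G x := by
      simp only [singularTerm, timeDeriv_logTerm]
      simp only [logTerm, singularCoef, Function.iterate_zero, id, hBdef]
      simp only [Nat.cast_zero, mul_zero, add_zero, mul_one, zero_mul, zero_add]
      field_simp
    have h3 : Real.exp (-(2 * ν) * τ) * Real.exp (2 * ν * τ) = 1 := by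
      rw [← Real.exp_add]; simp
    rw [h2]
    linear_combination -timeDeriv u τ x * h3
  have hsm := hu.sub h1.smooth
  -- The argument gives the exponent `2 - 2ν`, which is zero for `ν = 1`; it is lowered to `1 - 2ν <
  -- 0` so that integration up to time `0` applies.
  have hdec : Decay (1 - 2 * ν) (timeDeriv fun τ x => u τ x - singularTerm ν w B 0 τ x) := by
    rw [hder]
    exact (hGd.exp_mul ((hu.timeDeriv.exp_mul (2 * ν) 1).sub (jointlySmooth_of_space hGs)) _ _).mono
      (by linarith)
  exact ⟨hsm, decay_of_timeDeriv_of_neg (by linarith) hsm hdec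
    ((h0.mono (by linarith : -2 * ν - 1 ≤ -2 * ν)).sub h1.decay hu h1.smooth).bounded_zero, hdec⟩

/-- The free regular coefficient. -/
theorem exists_regular_data (hν : 1 ≤ ν) (hν' : ν ≤ 5 / 2) (hu : JointlySmooth u)
    (hp : ∀ τ, LatticePeriodic L (u τ)) (hs : SolvesWave ν w (fun _ _ => 0) u)
    {B : E3 → ℝ} (hB : TorusSmooth L B)
    (h : DecayC1 (1 - 2 * ν) fun τ x => u τ x - singularTerm ν w B 0 τ x) :
    ∃ A, TorusSmooth L A ∧ DecayC1 1 fun τ x =>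
      u τ x - (∑ j ∈ Finset.range 4, singularTerm ν w B j τ x) - A x := by
  set r : ℝ → E3 → ℝ := fun τ x => u τ x - ∑ j ∈ Finset.range 4, singularTerm ν w B j τ x with hr
  have hSs : JointlySmooth fun τ x => ∑ j ∈ Finset.range 4, singularTerm ν w B j τ x :=
    JointlySmooth.sum fun j => logTerm_smooth _ _ _ (hB.lap_iterate j).1
  have hr1 : DecayC1 (1 - 2 * ν) r := by
    have h1 : r = fun τ x => (u τ x - singularTerm ν w B 0 τ x)
        - ∑ j ∈ Finset.range 3, singularTerm ν w B (j + 1) τ x := by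
      funext τ x
      simp only [hr, Finset.sum_range_succ' _ 3]
      ring
    rw [h1]
    exact h.sub (DecayC1.sum 3 fun j => singularTerm_decayC1 hB (j + 1) (by
      push_cast; nlinarith [(Nat.cast_nonneg j : (0 : ℝ) ≤ j)]))
  -- Four singular terms suffice: the leftover forcing decays with exponent `7 - 2ν ≥ 2`, by `ν ≤
  -- 5/2`.
  have hlast := singularTerm_decayC1 (ν := ν) (w := w) hB 3 (σ := 5 - 2 * ν) (by push_cast; linarith)
  have hwave := hs.sub (singularTerm_solvesWave (w := w) (by linarith : 0 < ν) hB.1 3) hu hSs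
  have hhs : JointlySmooth fun τ x => (0 : ℝ) - -w * Real.exp (2 * τ)
      * lap (singularTerm ν w B 3 τ) x :=
    (jointlySmooth_of_space contDiff_const).sub (hlast.smooth.lap.exp_mul 2 (-w))
  have hh : Decay 2 fun τ x => (0 : ℝ) - -w * Real.exp (2 * τ)
      * lap (singularTerm ν w B 3 τ) x :=
    decay_zero.sub (((hlast.decay.lap hlast.smooth).exp_mul hlast.smooth.lap 2 (-w)).mono
      (by linarith)) (jointlySmooth_of_space contDiff_const) (hlast.smooth.lap.exp_mul 2 (-w))
  have gain : ∀ σ m : ℝ, Decay σ r → m ≤ σ + 2 → m ≤ 2 → 0 < 2 * ν + m → Decay m (timeDeriv r) :=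
    fun σ m hσ h1 h2 h3 => hwave.decay_timeDeriv (δ := 1) hr1.smooth hhs one_pos
      hr1.decay_timeDeriv hσ (hh.mono h2) h1 h3
  have gain' : ∀ σ m : ℝ, Decay σ r → m ≤ σ + 2 → m < 0 → 0 < 2 * ν + m → Decay m r :=
    fun σ m hσ h1 h2 h3 => decay_of_timeDeriv_of_neg h2 hr1.smooth
      (gain σ m hσ h1 (by linarith) h3) hσ.bounded_zero
  -- The exponent climbs through `1 - 2ν`, `-ν` and `-1/2`, at most two at a time; these stay
  -- negative so that no limit is needed yet. The last step gives `r'` the exponent `1`, and `r`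
  -- converges.
  have h1 := gain' _ (-ν) hr1.decay (by linarith) (by linarith) (by linarith)
  have h2 := gain' _ (-(1 / 2)) h1 (by linarith) (by linarith) (by linarith)
  have h3 := gain _ 1 h2 (by linarith) (by linarith) (by linarith)
  obtain ⟨A, hAs, hAt, hAd⟩ := exists_limit_of_timeDeriv one_pos hr1.smooth h3
  have hAp : LatticePeriodic L A := periodic_of_tendsto (fun τ v hv x => by
    simp only [hr, singularTerm, logTerm, hp τ v hv x, (hB.lap_iterate _).2 v hv x]) hAt
  refine ⟨A, ⟨hAs, hAp⟩, hr1.smooth.sub (jointlySmooth_of_space hAs), hAd, ?_⟩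
  rw [timeDeriv_sub hr1.smooth (jointlySmooth_of_space hAs)]
  have : timeDeriv (fun _ : ℝ => A) = fun _ _ => 0 := by
    funext τ x; simp [timeDeriv]
  simpa only [this, sub_zero] using h3

/-- Repeated gains of two, starting from exponent `1`, until the cap `2J - 2ν` is reached. The
forcing left by the two truncated sums is small enough for this cap. -/
theorem decay_remainder (hν : 1 ≤ ν) (hν' : ν ≤ 5 / 2) (hu : JointlySmooth u)
    (hs : SolvesWave ν w (fun _ _ => 0) u) {A B : E3 → ℝ} (hA : TorusSmooth L A)
    (hB : TorusSmooth L B)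
    (h : DecayC1 1 fun τ x => u τ x - (∑ j ∈ Finset.range 4, singularTerm ν w B j τ x) - A x)
    {J : ℕ} (hJ : 3 ≤ J) :
    Decay (2 * J - 2 * ν) fun τ x => u τ x
      - (∑ j ∈ Finset.range (J + 1), singularTerm ν w B j τ x)
      - ∑ j ∈ Finset.range (J + 1), regularTerm ν w A j τ x := by
  have hSs : ∀ n, JointlySmooth fun τ x => ∑ j ∈ Finset.range n, singularTerm ν w B j τ x :=
    fun n => JointlySmooth.sum fun j => logTerm_smooth _ _ _ (hB.lap_iterate j).1
  have hRs : ∀ n, JointlySmooth fun τ x => ∑ j ∈ Finset.range n, regularTerm ν w A j τ x :=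
    fun n => JointlySmooth.sum fun j => logTerm_smooth _ _ _ (hA.lap_iterate j).1
  have h1 : DecayC1 1 fun τ x => u τ x
      - (∑ j ∈ Finset.range (J + 1), singularTerm ν w B j τ x)
      - ∑ j ∈ Finset.range (J + 1), regularTerm ν w A j τ x := by
    induction J, hJ using Nat.le_induction with
    | base =>
      have h2 := h.sub (DecayC1.sum 3 fun j => regularTerm_decayC1 (ν := ν) (w := w) hA (j + 1)
        (σ := 1) (by push_cast; linarith [(Nat.cast_nonneg j : (0 : ℝ) ≤ j)]))
      convert h2 using 3
      simp only [Finset.sum_range_succ' _ 3]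
      simp only [regularTerm, logTerm, regularCoef, Nat.cast_zero, mul_zero, zero_mul,
        Real.exp_zero, Function.iterate_zero, id]
      ring
    | succ J hJ ih =>
      have hJ' : (3 : ℝ) ≤ J := by exact_mod_cast hJ
      have h2 := (ih.sub (singularTerm_decayC1 (ν := ν) (w := w) hB (J + 1) (σ := 1)
        (by push_cast; linarith))).sub (regularTerm_decayC1 (ν := ν) (w := w) hA (J + 1) (σ := 1)
        (by push_cast; linarith))
      convert h2 using 3
      rw [Finset.sum_range_succ _ (J + 1), Finset.sum_range_succ _ (J + 1)]
      ring
  have hJ' : (3 : ℝ) ≤ J := by exact_mod_cast hJ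
  -- The loss of `1` makes room for a logarithm; the factor `e^{2τ}` in the forcing more than makes
  -- up for it.
  have hlB := singularTerm_decayC1 (ν := ν) (w := w) hB J (σ := 2 * J - 2 * ν - 1) (by linarith)
  have hlA := regularTerm_decayC1 (ν := ν) (w := w) hA J (σ := 2 * J - 2 * ν - 1) (by linarith)
  have hwave := (hs.sub (singularTerm_solvesWave (w := w) (by linarith : 0 < ν) hB.1 J) hu
    (hSs _)).sub (regularTerm_solvesWave (w := w) (by linarith : 0 < ν) hA.1 J)
    (hu.sub (hSs _)) (hRs _)
  have e1 := (jointlySmooth_of_space (contDiff_const (c := (0 : ℝ)))).sub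
    (hlB.smooth.lap.exp_mul 2 (-w))
  have e2 := hlA.smooth.lap.exp_mul 2 (-w)
  have hh := (decay_zero.sub ((hlB.decay.lap hlB.smooth).exp_mul hlB.smooth.lap 2 (-w))
    (jointlySmooth_of_space contDiff_const) (hlB.smooth.lap.exp_mul 2 (-w))).sub
    ((hlA.decay.lap hlA.smooth).exp_mul hlA.smooth.lap 2 (-w)) e1 e2
  have key : ∀ i : ℕ, Decay (min (1 + 2 * (i : ℝ)) (2 * J - 2 * ν)) fun τ x => u τ x
      - (∑ j ∈ Finset.range (J + 1), singularTerm ν w B j τ x)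
      - ∑ j ∈ Finset.range (J + 1), regularTerm ν w A j τ x := by
    intro i
    induction i with
    | zero => exact h1.decay.mono (by simp)
    | succ i ih =>
      have hpos : 0 < min (1 + 2 * ((i + 1 : ℕ) : ℝ)) (2 * J - 2 * ν) :=
        lt_min (by positivity) (by linarith)
      have h2 := hwave.decay_timeDeriv (δ := 1) (m := min (1 + 2 * ((i + 1 : ℕ) : ℝ))
        (2 * J - 2 * ν)) h1.smooth (e1.sub e2) one_pos (h1.decay_timeDeriv.mono (by linarith)) ih
        (hh.mono ((min_le_right _ _).trans (by linarith))) (by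
          rw [← min_add_add_right]
          refine min_le_min ?_ (by linarith)
          push_cast
          linarith) (by linarith)
      exact decay_of_timeDeriv_of_pos hpos h1.smooth h2 one_pos h1.decay
  -- `J` gains are enough, since `1 + 2J ≥ 2J - 2ν`.
  refine (key J).mono (le_min (by linarith) le_rfl)

/-- The asymptotic expansion in logarithmic time. -/
theorem exists_expansion (hν : 1 ≤ ν) (hν' : ν ≤ 5 / 2) (hw : 0 ≤ w) (hu : JointlySmooth u)
    (hp : ∀ τ, LatticePeriodic L (u τ)) (hs : SolvesWave ν w (fun _ _ => 0) u) :
    ∃ A B, TorusSmooth L A ∧ TorusSmooth L B ∧ ∀ J : ℕ, 3 ≤ J →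
      Decay (2 * J - 2 * ν) fun τ x => u τ x
        - (∑ j ∈ Finset.range (J + 1), singularTerm ν w B j τ x)
        - ∑ j ∈ Finset.range (J + 1), regularTerm ν w A j τ x := by
  obtain ⟨B, hB, h1⟩ := exists_singular_data hν hw hu hp hs
  obtain ⟨A, hA, h2⟩ := exists_regular_data hν hν' hu hp hs hB h1
  exact ⟨A, B, hA, hB, fun J hJ => decay_remainder hν hν' hu hs hA hB h2 hJ⟩

end Expansion

/-! ### Powers of the Laplacian as constant coefficient operators. -/

section WordOperators

theorem constCoeffOp_zero (f : E3 → ℝ) : constCoeffOp 0 f = fun _ => 0 := by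
  funext x
  simp [constCoeffOp]

theorem constCoeffOp_smul (a : ℝ) (P : List (Fin 3) →₀ ℝ) (f : E3 → ℝ) (x : E3) :
    constCoeffOp (a • P) f x = a * constCoeffOp P f x := by
  simp only [constCoeffOp]
  rw [Finsupp.sum_smul_index (by simp), Finsupp.mul_sum]
  simp only [mul_assoc]

/-- The words, with multiplicity, of the `j`-th power of the Laplacian. -/
noncomputable def lapWord : ℕ → List (Fin 3) →₀ ℝ
  | 0 => Finsupp.single [] 1
  | j + 1 => ∑ i, (lapWord j).mapDomain fun α => i :: i :: α

theorem constCoeffOp_lapWord {f : E3 → ℝ} (hf : ContDiff ℝ ∞ f) (j : ℕ) :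
    constCoeffOp (lapWord j) f = lap^[j] f := by
  induction j with
  | zero =>
    funext x
    simp [constCoeffOp, lapWord, spatialDeriv_nil]
  | succ j ih =>
    rw [Function.iterate_succ_apply', ← ih]
    funext x
    have h1 : constCoeffOp (lapWord (j + 1)) f x
        = ∑ i, (lapWord j).sum fun α a => a * spatialDeriv (i :: i :: α) f x := by
      simp only [constCoeffOp, lapWord]
      rw [← Finsupp.sum_finsetSum_index (by simp) (by intros; ring)]
      refine Finset.sum_congr rfl fun i _ => ?_
      rw [Finsupp.sum_mapDomain_index (by simp) (by intros; ring)]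
    rw [h1]
    refine Finset.sum_congr rfl fun i _ => ?_
    have h2 := congrFun (spatialDeriv_sum (lapWord j).support
      (f := fun α x => lapWord j α * spatialDeriv α f x)
      (fun α => contDiff_const.mul (spatialDeriv_smooth hf α)) [i, i]) x
    refine Eq.trans ?_ h2.symm
    refine Finset.sum_congr rfl fun α _ => ?_
    rw [spatialDeriv_const_mul (spatialDeriv_smooth hf α)]
    rfl

end WordOperators

/-! ### Sequences viewed as functions of a real exponent. -/

section EvenExtension

variable {X : Type*} [Zero X]

/-- The extension by zero of `2 j ↦ g j` to the real numbers. -/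
noncomputable def evenExt (g : ℕ → X) (s : ℝ) : X :=
  if s = 2 * (⌊s / 2⌋₊ : ℝ) then g ⌊s / 2⌋₊ else 0

theorem evenExt_two_mul (g : ℕ → X) (j : ℕ) : evenExt g (2 * j) = g j := by
  have : ⌊(2 * (j : ℝ)) / 2⌋₊ = j := by
    rw [mul_div_cancel_left₀ _ two_ne_zero, Nat.floor_natCast]
  rw [evenExt, this, if_pos rfl]

theorem evenExt_eq_zero {g : ℕ → X} {s : ℝ} (h : ∀ j : ℕ, s = 2 * j → g j = 0) :
    evenExt g s = 0 := by
  rw [evenExt]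
  split_ifs with hs
  · exact h _ hs
  · rfl

/-- The second alternative ranges over all targets and all `g`, so one case distinction serves
several extensions at once. -/
theorem evenExt_cases (s : ℝ) : (∃ j : ℕ, s = 2 * j) ∨
    ∀ {X : Type} [Zero X] (g : ℕ → X), evenExt g s = 0 := by
  by_cases h : ∃ j : ℕ, s = 2 * j
  · exact Or.inl h
  · exact Or.inr fun g => evenExt_eq_zero fun j hj => absurd ⟨j, hj⟩ h

/-- Transfers a recursion over `ℕ` to all real exponents. The first term has no predecessor, hence
the separate condition at `s = 0`. -/
theorem evenExt_recursion {g g' g'' : ℕ → ℝ} {a b w s : ℝ}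
    (h0 : s = 0 → a * g 0 = -(b * g'' 0))
    (h : ∀ j : ℕ, s = 2 * ((j + 1 : ℕ) : ℝ) → a * g (j + 1) = w * g' j - b * g'' (j + 1)) :
    a * evenExt g s = w * evenExt g' (s - 2) - b * evenExt g'' s := by
  rcases evenExt_cases s with ⟨j, rfl⟩ | hs
  · rw [evenExt_two_mul, evenExt_two_mul]
    cases j with
    | zero =>
      rw [evenExt_eq_zero (fun i hi => ?_), h0 (by simp)]
      · ring
      · have : (0 : ℝ) ≤ i := Nat.cast_nonneg i
        norm_num at hi
        linarith
    | succ j =>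
      have : (2 * ((j + 1 : ℕ) : ℝ) - 2) = 2 * (j : ℝ) := by push_cast; ring
      rw [this, evenExt_two_mul, h j rfl]
  · rw [hs, hs, evenExt_eq_zero (fun i hi => ?_)]
    · ring
    · have h1 : s = 2 * ((i + 1 : ℕ) : ℝ) := by push_cast; linarith
      -- The constant sequence `1` detects that `s` would be an even natural number after all.
      have h2 := hs (fun _ => (1 : ℝ))
      rw [h1, evenExt_two_mul] at h2
      exact absurd h2 one_ne_zero

/-- Reindexing: the nonzero terms sit at those `n` with `κ n = s + 2j`, and `n ≤ N` means `s + 2j ≤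
κ N`. The number `M` is any sufficiently large cut-off. -/
theorem sum_evenExt {κ : ℕ → ℝ} (hκ : StrictMono κ) {s : ℝ} (hc : ∀ j : ℕ, ∃ n, κ n = s + 2 * j)
    {N M : ℕ} (hM : ∀ j : ℕ, s + 2 * j ≤ κ N → j < M) (g : ℕ → ℝ) :
    ∑ n ∈ Finset.range (N + 1), evenExt g (κ n - s)
      = ∑ j ∈ Finset.range M, if s + 2 * j ≤ κ N then g j else 0 := by
  choose e he using hc
  rw [← Finset.sum_filter]
  symm
  refine Finset.sum_of_injOn e ?_ ?_ ?_ ?_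
  · intro i _ j _ hij
    have h1 := he i
    rw [hij, he j] at h1
    have : (j : ℝ) = i := by linarith
    exact_mod_cast this.symm
  · intro j hj
    have h1 := (Finset.mem_filter.1 hj).2
    rw [← he, hκ.le_iff_le] at h1
    exact Finset.mem_coe.2 (Finset.mem_range.2 (Nat.lt_succ_of_le h1))
  · intro n hn hne
    refine evenExt_eq_zero fun j hj => absurd ?_ hne
    have h1 : κ n = κ (e j) := by rw [he]; linarith
    refine ⟨j, ?_, (hκ.injective h1).symm⟩
    have h2 : s + 2 * j ≤ κ N := by
      rw [← he, ← h1]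
      exact hκ.monotone (Nat.le_of_lt_succ (Finset.mem_range.1 hn))
    exact Finset.mem_coe.2 (Finset.mem_filter.2 ⟨Finset.mem_range.2 (hM j h2), h2⟩)
  · intro j _
    have : κ (e j) - s = 2 * j := by rw [he]; ring
    rw [this, evenExt_two_mul]

end EvenExtension

/-! ### The common sequence of exponents. -/

section Exponents

/-- A sequence of exponents that contains `-2 ν + 2 j` and `2 j` for every natural number `j`. -/
theorem exists_exponents {ν : ℝ} (hν : 0 < ν) : ∃ κ : ℕ → ℝ, StrictMono κ ∧
    Filter.Tendsto κ Filter.atTop Filter.atTop ∧ (∀ n, -2 * ν ≤ κ n) ∧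
    (∀ j : ℕ, ∃ n, κ n = -2 * ν + 2 * j) ∧ ∀ j : ℕ, ∃ n, κ n = 0 + 2 * j := by
  by_cases h : ∃ m : ℕ, ν = m
  · obtain ⟨m, rfl⟩ := h
    refine ⟨fun n => -2 * (m : ℝ) + 2 * n, fun a b hab => ?_, ?_, fun n => ?_, fun j => ⟨j, rfl⟩,
      fun j => ⟨j + m, ?_⟩⟩
    · have : (a : ℝ) < b := by exact_mod_cast hab
      simpa using this
    · exact Filter.tendsto_atTop_add_const_left _ _
        (tendsto_natCast_atTop_atTop.const_mul_atTop two_pos)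
    · simp
    · push_cast; ring
  · set m := ⌊ν⌋₊ with hm
    have h1 : (m : ℝ) < ν := lt_of_le_of_ne (Nat.floor_le hν.le) fun h' => h ⟨m, h'.symm⟩
    have h2 : ν < m + 1 := Nat.lt_floor_add_one ν
    -- The ladders `-2ν + 2j` and `-2m + 2j` are disjoint and alternate strictly because `m < ν < m
    -- + 1`. The second one starts below `0` to keep the alternation from the outset.
    set κ : ℕ → ℝ := fun n => -2 * ν + 2 * ((n / 2 : ℕ) : ℝ) + ((n % 2 : ℕ) : ℝ) * (2 * ν - 2 * m)
      with hκ
    have heven : ∀ j : ℕ, κ (2 * j) = -2 * ν + 2 * j := fun j => by simp [hκ]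
    have hodd : ∀ j : ℕ, κ (2 * j + 1) = 2 * j - 2 * m := fun j => by
      have e1 : (2 * j + 1) / 2 = j := by omega
      have e2 : (2 * j + 1) % 2 = 1 := by omega
      simp only [hκ, e1, e2]
      push_cast; ring
    refine ⟨κ, strictMono_nat_of_lt_succ fun n => ?_, ?_, fun n => ?_, fun j => ⟨2 * j, heven j⟩,
      fun j => ⟨2 * (j + m) + 1, by rw [hodd]; push_cast; ring⟩⟩
    · rcases Nat.even_or_odd' n with ⟨j, rfl | rfl⟩
      · rw [heven, hodd]; linarith
      · have : 2 * j + 1 + 1 = 2 * (j + 1) := by ring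
        rw [this, heven, hodd]; push_cast; linarith
    · have h3 : ∀ n : ℕ, -2 * ν - 1 + n ≤ κ n := by
        intro n
        rcases Nat.even_or_odd' n with ⟨j, rfl | rfl⟩
        · rw [heven]; push_cast; linarith
        · rw [hodd]; push_cast; linarith
      exact Filter.tendsto_atTop_mono h3
        (Filter.tendsto_atTop_add_const_left _ _ tendsto_natCast_atTop_atTop)
    · have h3 : (0 : ℝ) ≤ ((n % 2 : ℕ) : ℝ) * (2 * ν - 2 * m) :=
        mul_nonneg (Nat.cast_nonneg _) (by linarith)
      have h4 : (0 : ℝ) ≤ ((n / 2 : ℕ) : ℝ) := Nat.cast_nonneg _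
      simp only [hκ]
      linarith

end Exponents

/-! ### The coefficients, their recursion, and the asymptotic statement. -/

section Coefficients

variable {ν w : ℝ} {A B : E3 → ℝ}

/-- The scalar in front of `Δ^j B` in the coefficient with index `l`. -/
noncomputable def singularScalar (ν w : ℝ) (l : Fin 2) (j : ℕ) : ℝ :=
  ![(singularCoef ν w j).1, (singularCoef ν w j).2] l

/-- The scalar in front of `Δ^j A` in the coefficient with index `l`. -/
noncomputable def regularScalar (ν w : ℝ) (l : Fin 2) (j : ℕ) : ℝ :=
  ![regularCoef ν w j, 0] l

/-- The coefficients of the expansion of the solution with data `A` and `B`. -/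
noncomputable def coef (ν w : ℝ) (A B : E3 → ℝ) (k : ℝ) (l : Fin 2) : E3 → ℝ := fun x =>
  evenExt (fun j => singularScalar ν w l j * lap^[j] B x) (k + 2 * ν)
    + evenExt (fun j => regularScalar ν w l j * lap^[j] A x) k

theorem evenExt_smooth {g : ℕ → E3 → ℝ} (hg : ∀ j, ContDiff ℝ ∞ (g j)) (s : ℝ) :
    ContDiff ℝ ∞ fun x => evenExt (fun j => g j x) s := by
  rcases evenExt_cases s with ⟨j, rfl⟩ | h
  · simpa only [evenExt_two_mul] using hg j
  · simpa only [h] using contDiff_const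

theorem evenExt_torusSmooth {L : Submodule ℤ E3} {f : E3 → ℝ} (hf : TorusSmooth L f) (a : ℕ → ℝ)
    (s : ℝ) : TorusSmooth L fun x => evenExt (fun j => a j * lap^[j] f x) s :=
  ⟨evenExt_smooth (fun j => contDiff_const.mul (hf.lap_iterate j).1) s, fun v hv x => by
    simp only [(hf.lap_iterate _).2 v hv x]⟩

theorem lap_evenExt {f : E3 → ℝ} (hf : ContDiff ℝ ∞ f) (a : ℕ → ℝ) (s : ℝ) :
    lap (fun x => evenExt (fun j => a j * lap^[j] f x) s)
      = fun x => evenExt (fun j => a j * lap^[j + 1] f x) s := by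
  rcases evenExt_cases s with ⟨j, rfl⟩ | h
  · simp only [evenExt_two_mul]
    rw [lap_const_mul (lap_iterate_smooth hf j), Function.iterate_succ_apply']
  · simp only [h]
    simpa using lap_const_mul (f := fun _ => (0 : ℝ)) contDiff_const 0

theorem coef_torusSmooth {L : Submodule ℤ E3} (hA : TorusSmooth L A) (hB : TorusSmooth L B)
    (k : ℝ) (l : Fin 2) : TorusSmooth L (coef ν w A B k l) := by
  have h1 := evenExt_torusSmooth hB (singularScalar ν w l) (k + 2 * ν)
  have h2 := evenExt_torusSmooth hA (regularScalar ν w l) k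
  exact ⟨h1.1.add h2.1, fun v hv x => congrArg₂ (· + ·) (h1.2 v hv x) (h2.2 v hv x)⟩

theorem laplacian_coef (hA : ContDiff ℝ ∞ A) (hB : ContDiff ℝ ∞ B) (k : ℝ) (l : Fin 2) (x : E3) :
    (Δ (coef ν w A B k l)) x
      = evenExt (fun j => singularScalar ν w l j * lap^[j + 1] B x) (k + 2 * ν)
        + evenExt (fun j => regularScalar ν w l j * lap^[j + 1] A x) k := by
  have h1 := evenExt_smooth (fun j => contDiff_const.mul (lap_iterate_smooth hB j))
    (g := fun j x => singularScalar ν w l j * lap^[j] B x) (k + 2 * ν)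
  have h2 := evenExt_smooth (fun j => contDiff_const.mul (lap_iterate_smooth hA j))
    (g := fun j x => regularScalar ν w l j * lap^[j] A x) k
  unfold coef
  rw [laplacian_eq_lap (h1.add h2), lap_add h1 h2, lap_evenExt hB, lap_evenExt hA]

theorem coef_singular (hν : 0 < ν) : coef ν w A B (-2 * ν) 0 = B := by
  funext x
  have h : -2 * ν + 2 * ν = 2 * ((0 : ℕ) : ℝ) := by simp
  rw [coef, h, evenExt_two_mul, evenExt_eq_zero (s := -2 * ν) fun j hj => ?_]
  · simp [singularScalar, singularCoef]
  · have : (0 : ℝ) ≤ j := Nat.cast_nonneg j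
    linarith

/-- For integer `ν` the singular ladder also meets exponent `0`, but its contribution there was
normalised to zero. -/
theorem coef_regular (hν : 0 < ν) : coef ν w A B 0 0 = A := by
  funext x
  have h : (0 : ℝ) = 2 * ((0 : ℕ) : ℝ) := by simp
  rw [coef, evenExt_eq_zero fun j hj => ?_]
  · rw [h, evenExt_two_mul]
    simp [regularScalar, regularCoef]
  · have : (j : ℝ) = ν := by linarith
    simp [singularScalar, singularCoef_fst_eq_zero hν this]

theorem constCoeffOp_evenExt {f : E3 → ℝ} (hf : ContDiff ℝ ∞ f) (a : ℕ → ℝ) (s : ℝ) (x : E3) :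
    evenExt (fun j => a j * lap^[j] f x) s
      = constCoeffOp (evenExt (fun j => a j • lapWord j) s) f x := by
  rcases evenExt_cases s with ⟨j, rfl⟩ | h
  · rw [evenExt_two_mul, evenExt_two_mul, constCoeffOp_smul, constCoeffOp_lapWord hf]
  · rw [h, h, constCoeffOp_zero]

/-- Logarithms start at `j = n = ν`, so their exponents are `-2ν + 2j = 2(j - n)` with `j ≥ n`. -/
theorem exists_of_coef_one_ne_zero {k : ℝ} (h : coef ν w A B k 1 ≠ 0) :
    ∃ n i : ℕ, ν = n ∧ k = 2 * i := by
  by_contra hn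
  refine h (funext fun x => ?_)
  rw [coef, evenExt_eq_zero (s := k) (fun j _ => by simp [regularScalar]),
    evenExt_eq_zero (fun j hj => ?_)]
  · simp
  · by_contra h0
    have h1 : (singularCoef ν w j).2 ≠ 0 := fun h2 => h0 (by simp [singularScalar, h2])
    obtain ⟨n, hνn, hnj⟩ := exists_nat_of_singularCoef_snd_ne_zero h1
    refine hn ⟨n, j - n, hνn, ?_⟩
    rw [Nat.cast_sub hnj, ← hνn]
    linarith

theorem exists_of_coef_ne_zero {k : ℝ} {l : Fin 2} (h : coef ν w A B k l ≠ 0) :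
    ∃ i : ℕ, k = -2 * ν + 2 * i ∨ k = 2 * i := by
  by_contra! hn
  refine h (funext fun x => ?_)
  rw [coef, evenExt_eq_zero (s := k) (fun j hj => absurd hj (hn j).2),
    evenExt_eq_zero (fun j hj => absurd (by linarith) (hn j).1)]
  simp

theorem coef_recursion_zero (hν : 0 < ν) (hA : ContDiff ℝ ∞ A) (hB : ContDiff ℝ ∞ B) (k : ℝ)
    (x : E3) : k * (k + 2 * ν) * coef ν w A B k 0 x
      = w * (Δ (coef ν w A B (k - 2) 0)) x - (2 * k + 2 * ν) * coef ν w A B k 1 x := by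
  rw [laplacian_coef hA hB]
  have h1 := evenExt_recursion (g := fun j => singularScalar ν w 0 j * lap^[j] B x)
    (g' := fun j => singularScalar ν w 0 j * lap^[j + 1] B x)
    (g'' := fun j => singularScalar ν w 1 j * lap^[j] B x)
    (a := k * (k + 2 * ν)) (b := 2 * k + 2 * ν) (w := w) (s := k + 2 * ν)
    (fun h => by simp [h, singularScalar, singularCoef]) (fun j hj => by
      have hk : k = 2 * ((j + 1 : ℕ) : ℝ) - 2 * ν := by linarith
      have := singularCoef_fst_succ (w := w) hν j
      simp only [singularScalar, Matrix.cons_val_zero, Matrix.cons_val_one, hk]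
      linear_combination lap^[j + 1] B x * this)
  have h2 := evenExt_recursion (g := fun j => regularScalar ν w 0 j * lap^[j] A x)
    (g' := fun j => regularScalar ν w 0 j * lap^[j + 1] A x)
    (g'' := fun j => regularScalar ν w 1 j * lap^[j] A x)
    (a := k * (k + 2 * ν)) (b := 2 * k + 2 * ν) (w := w) (s := k)
    (fun h => by simp [h, regularScalar]) (fun j hj => by
      have := regularCoef_succ (w := w) hν j
      simp only [regularScalar, Matrix.cons_val_zero, Matrix.cons_val_one, hj]
      linear_combination lap^[j + 1] A x * this)
  have h3 : k - 2 + 2 * ν = k + 2 * ν - 2 := by ring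
  rw [h3]
  simp only [coef]
  linear_combination h1 + h2

theorem coef_recursion_one (hA : ContDiff ℝ ∞ A) (hB : ContDiff ℝ ∞ B) (k : ℝ)
    (x : E3) : k * (k + 2 * ν) * coef ν w A B k 1 x = w * (Δ (coef ν w A B (k - 2) 1)) x := by
  rw [laplacian_coef hA hB]
  have h1 := evenExt_recursion (g := fun j => singularScalar ν w 1 j * lap^[j] B x)
    (g' := fun j => singularScalar ν w 1 j * lap^[j + 1] B x)
    (g'' := fun j => singularScalar ν w 1 j * lap^[j] B x)
    (a := k * (k + 2 * ν)) (b := 0) (w := w) (s := k + 2 * ν)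
    (fun h => by simp [h]) (fun j hj => by
      have hk : k = 2 * ((j + 1 : ℕ) : ℝ) - 2 * ν := by linarith
      have := singularCoef_snd_succ (ν := ν) (w := w) j
      simp only [singularScalar, Matrix.cons_val_zero, Matrix.cons_val_one, hk]
      linear_combination lap^[j + 1] B x * this)
  have h2 : ∀ (i : ℕ → ℕ) (s : ℝ),
      evenExt (fun j => regularScalar ν w 1 j * lap^[i j] A x) s = 0 :=
    fun i s => evenExt_eq_zero fun j _ => by simp [regularScalar]
  have h3 : k - 2 + 2 * ν = k + 2 * ν - 2 := by ring
  rw [h3]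
  simp only [coef, h2]
  linear_combination h1

theorem coef_term_eq (k τ : ℝ) (x : E3) :
    (coef ν w A B k 0 x + coef ν w A B k 1 x * τ) * Real.exp (k * τ)
      = evenExt (fun j => singularTerm ν w B j τ x) (k - -2 * ν)
        + evenExt (fun j => regularTerm ν w A j τ x) (k - 0) := by
  have h0 : k - -2 * ν = k + 2 * ν := by ring
  have h1 : (evenExt (fun j => singularScalar ν w 0 j * lap^[j] B x) (k + 2 * ν)
      + evenExt (fun j => singularScalar ν w 1 j * lap^[j] B x) (k + 2 * ν) * τ) * Real.exp (k * τ)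
      = evenExt (fun j => singularTerm ν w B j τ x) (k + 2 * ν) := by
    rcases evenExt_cases (k + 2 * ν) with ⟨j, hj⟩ | h
    · have hk : k = -2 * ν + 2 * j := by linarith
      rw [hj]
      simp only [evenExt_two_mul, singularTerm, logTerm, singularScalar, Matrix.cons_val_zero,
        Matrix.cons_val_one]
      rw [hk]
      ring
    · simp [h]
  have h2 : (evenExt (fun j => regularScalar ν w 0 j * lap^[j] A x) k
      + evenExt (fun j => regularScalar ν w 1 j * lap^[j] A x) k * τ) * Real.exp (k * τ)
      = evenExt (fun j => regularTerm ν w A j τ x) k := by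
    rcases evenExt_cases k with ⟨j, hj⟩ | h
    · simp only [hj, evenExt_two_mul, regularTerm, logTerm, regularScalar, Matrix.cons_val_zero,
        Matrix.cons_val_one]
      ring
    · simp [h]
  rw [h0, sub_zero, ← h1, ← h2]
  simp only [coef]
  ring

theorem partialSum_exp (κ : ℕ → ℝ) (N : ℕ) (τ : ℝ) (x : E3) :
    partialSum κ (coef ν w A B) N (Real.exp τ) x
      = ∑ n ∈ Finset.range (N + 1), evenExt (fun j => singularTerm ν w B j τ x) (κ n - -2 * ν)
        + ∑ n ∈ Finset.range (N + 1), evenExt (fun j => regularTerm ν w A j τ x) (κ n - 0) := by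
  rw [← Finset.sum_add_distrib]
  refine Finset.sum_congr rfl fun n _ => ?_
  rw [← coef_term_eq, Real.log_exp, ← Real.exp_mul, mul_comm τ]

/-- A much longer expansion is used, and its terms beyond `κ N` are put back into the remainder.
Their exponents are at least `κ (N + 1)`, so a `σ` strictly between `κ N` and `κ (N + 1)` also
absorbs logarithms. -/
theorem decay_sub_partialSum {L : Submodule ℤ E3} [DiscreteTopology L] [IsZLattice ℝ L]
    {u : ℝ → E3 → ℝ} (hu : JointlySmooth u) (hA : TorusSmooth L A) (hB : TorusSmooth L B)
    (h : ∀ J : ℕ, 3 ≤ J → Decay (2 * J - 2 * ν) fun τ x => u τ x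
      - (∑ j ∈ Finset.range (J + 1), singularTerm ν w B j τ x)
      - ∑ j ∈ Finset.range (J + 1), regularTerm ν w A j τ x)
    (hν : 0 < ν) {κ : ℕ → ℝ} (hκ : StrictMono κ) (h1 : ∀ j : ℕ, ∃ n, κ n = -2 * ν + 2 * j)
    (h2 : ∀ j : ℕ, ∃ n, κ n = 0 + 2 * j) (N : ℕ) :
    ∃ σ, κ N < σ ∧
      Decay σ fun τ x => u τ x - partialSum κ (coef ν w A B) N (Real.exp τ) x := by
  have hlt : κ N < κ (N + 1) := hκ N.lt_succ_self
  obtain ⟨σ, hσ, hσ'⟩ := exists_between hlt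
  refine ⟨σ, hσ, ?_⟩
  obtain ⟨J, hJ⟩ := exists_nat_ge (max 3 (κ (N + 1) / 2 + ν))
  have hJ3 : 3 ≤ J := by exact_mod_cast (le_max_left _ _).trans hJ
  have hJκ : κ (N + 1) ≤ 2 * J - 2 * ν := by
    have := (le_max_right _ _).trans hJ
    linarith
  have hsmall : ∀ s : ℝ, -2 * ν ≤ s → ∀ j : ℕ, s + 2 * j ≤ κ N → j < J + 1 := by
    intro s hs j hj
    have : (j : ℝ) < ((J + 1 : ℕ) : ℝ) := by push_cast; linarith
    exact_mod_cast this
  have hbig : ∀ s : ℝ, (∀ j : ℕ, ∃ n, κ n = s + 2 * j) → ∀ j : ℕ, ¬ s + 2 * j ≤ κ N →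
      σ < s + 2 * j := by
    intro s hs j hj
    obtain ⟨n, hn⟩ := hs j
    rw [← hn, hκ.le_iff_le, not_le] at hj
    rw [← hn]
    exact hσ'.trans_le (hκ.monotone hj)
  -- `U` and `V` collect the terms of the long expansion that the partial sum omits.
  set U : ℕ → ℝ → E3 → ℝ := fun j τ x =>
    if -2 * ν + 2 * j ≤ κ N then 0 else singularTerm ν w B j τ x with hU
  set V : ℕ → ℝ → E3 → ℝ := fun j τ x =>
    if 0 + 2 * j ≤ κ N then 0 else regularTerm ν w A j τ x with hV
  have hUd : ∀ j, DecayC1 σ (U j) := by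
    intro j
    by_cases hj : -2 * ν + 2 * j ≤ κ N
    · simpa only [hU, if_pos hj] using decayC1_zero
    · simpa only [hU, if_neg hj] using singularTerm_decayC1 hB j (hbig _ h1 j hj)
  have hVd : ∀ j, DecayC1 σ (V j) := by
    intro j
    by_cases hj : (0 : ℝ) + 2 * j ≤ κ N
    · simpa only [hV, if_pos hj] using decayC1_zero
    · simpa only [hV, if_neg hj] using
        regularTerm_decayC1 hA j (by simpa using hbig _ h2 j hj)
  have hUs := DecayC1.sum (J + 1) hUd
  have hVs := DecayC1.sum (J + 1) hVd
  have hSs : JointlySmooth fun τ x => ∑ j ∈ Finset.range (J + 1), singularTerm ν w B j τ x :=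
    JointlySmooth.sum fun j => logTerm_smooth _ _ _ (hB.lap_iterate j).1
  have hRs : JointlySmooth fun τ x => ∑ j ∈ Finset.range (J + 1), regularTerm ν w A j τ x :=
    JointlySmooth.sum fun j => logTerm_smooth _ _ _ (hA.lap_iterate j).1
  have hsm := (hu.sub hSs).sub hRs
  have hd := (((h J hJ3).mono (hσ'.le.trans hJκ)).add hUs.decay hsm hUs.smooth).add hVs.decay
    (hsm.add hUs.smooth) hVs.smooth
  convert hd using 3 with τ x
  rw [partialSum_exp, sum_evenExt hκ h1 (hsmall _ le_rfl),
    sum_evenExt hκ h2 (hsmall 0 (by linarith))]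
  have e1 : ∀ (c : ℕ → Prop) [DecidablePred c] (f : ℕ → ℝ),
      ∑ j ∈ Finset.range (J + 1), f j = (∑ j ∈ Finset.range (J + 1), if c j then f j else 0)
        + ∑ j ∈ Finset.range (J + 1), if c j then 0 else f j := by
    intro c _ f
    rw [← Finset.sum_add_distrib]
    refine Finset.sum_congr rfl fun j _ => ?_
    split_ifs <;> simp
  rw [e1 (fun j : ℕ => -2 * ν + 2 * (j : ℝ) ≤ κ N) fun j => singularTerm ν w B j τ x,
    e1 (fun j : ℕ => (0 : ℝ) + 2 * (j : ℝ) ≤ κ N) fun j => regularTerm ν w A j τ x]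
  simp only [hU, hV]
  ring

/-- A bound with an exponent strictly above `κ N` is little-o of `η ^ κ N`. -/
theorem isAsymptoticTo_of_decay {Φ : ℝ → E3 → ℝ} {κ : ℕ → ℝ} {c : ℝ → Fin 2 → E3 → ℝ}
    (h : ∀ N, ∃ σ, κ N < σ ∧
      Decay σ fun τ x => Φ (Real.exp τ) x - partialSum κ c N (Real.exp τ) x) :
    IsAsymptoticTo κ c Φ := by
  intro N α ε hε
  obtain ⟨σ, hσ, hd⟩ := h N
  obtain ⟨C, hC⟩ := hd α
  have ht : Filter.Tendsto (fun τ => C * Real.exp ((σ - κ N) * τ)) Filter.atBot (nhds 0) := by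
    simpa using (tendsto_exp_atBot_of_pos (sub_pos.2 hσ)).const_mul C
  obtain ⟨T, hT⟩ := Filter.eventually_atBot.1
    ((ht.eventually (gt_mem_nhds hε)).and (Filter.eventually_le_atBot 0))
  refine ⟨Real.exp T, Real.exp_pos T, fun η hη hηT x => ?_⟩
  have hlog : Real.log η ≤ T := by
    rw [← Real.log_exp T]
    exact Real.log_le_log hη hηT.le
  obtain ⟨h1, h2⟩ := hT _ hlog
  have h3 := hC _ h2 x
  simp only [Real.exp_log hη] at h3
  refine h3.trans ?_
  rw [Real.rpow_def_of_pos hη, mul_comm (Real.log η)]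
  have h4 : Real.exp (σ * Real.log η)
      = Real.exp ((σ - κ N) * Real.log η) * Real.exp (κ N * Real.log η) := by
    rw [← Real.exp_add]; ring_nf
  rw [h4, ← mul_assoc]
  exact mul_le_mul_of_nonneg_right h1.le (Real.exp_nonneg _)

end Coefficients

/-! ### Passage to logarithmic time and conclusion. -/

section Main

theorem nu_bounds {w : ℝ} (hw : w ∈ Set.Icc (0 : ℝ) 1) : 1 ≤ nu w ∧ nu w ≤ 5 / 2 := by
  obtain ⟨h0, h1⟩ := hw
  have h2 : 0 < 1 + 3 * w := by linarith
  have h3 : nu w = (5 + 3 * w) / (2 * (1 + 3 * w)) := by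
    rw [nu]; field_simp
  rw [h3, le_div_iff₀ (by linarith), div_le_iff₀ (by linarith)]
  constructor <;> linarith

theorem IsSmoothSolution.jointlySmooth_exp {w : ℝ} {L : Submodule ℤ E3} {Φ : ℝ → E3 → ℝ}
    (h : IsSmoothSolution w L Φ) : JointlySmooth fun τ => Φ (Real.exp τ) := by
  have h1 : ContDiff ℝ ∞ fun p : ℝ × E3 => (Real.exp p.1, p.2) :=
    (Real.contDiff_exp.comp contDiff_fst).prodMk contDiff_snd
  exact h.smooth.comp_contDiff h1 fun p => ⟨Real.exp_pos _, trivial⟩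

theorem IsSmoothSolution.solvesWave {w : ℝ} (hw : w ∈ Set.Icc (0 : ℝ) 1) {L : Submodule ℤ E3}
    {Φ : ℝ → E3 → ℝ} (h : IsSmoothSolution w L Φ) :
    SolvesWave (nu w) w (fun _ _ => 0) fun τ => Φ (Real.exp τ) := by
  intro τ x
  have hs : ContDiffOn ℝ ∞ (fun s => Φ s x) (Set.Ioi 0) :=
    h.smooth.comp (f := fun s : ℝ => (s, x)) (contDiff_id.prodMk contDiff_const).contDiffOn
      fun s hs => ⟨hs, trivial⟩
  have hd1 : ∀ η, 0 < η → HasDerivAt (fun s => Φ s x) (deriv (fun s => Φ s x) η) η := fun η hη =>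
    ((hs.differentiableOn (by simp)).differentiableAt (Ioi_mem_nhds hη)).hasDerivAt
  have hs' : ContDiffOn ℝ ∞ (deriv fun s => Φ s x) (Set.Ioi 0) :=
    hs.deriv_of_isOpen isOpen_Ioi (by simp)
  have hd2 : ∀ η, 0 < η → HasDerivAt (deriv fun s => Φ s x) (deriv (deriv fun s => Φ s x) η) η :=
    fun η hη => ((hs'.differentiableOn (by simp)).differentiableAt (Ioi_mem_nhds hη)).hasDerivAt
  have e1 : ∀ t, HasDerivAt (fun s => Φ (Real.exp s) x)
      (deriv (fun s => Φ s x) (Real.exp t) * Real.exp t) t := fun t =>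
    (hd1 _ (Real.exp_pos t)).comp t (Real.hasDerivAt_exp t)
  have e2 : (fun s => timeDeriv (fun τ => Φ (Real.exp τ)) s x)
      = fun t => deriv (fun s => Φ s x) (Real.exp t) * Real.exp t := funext fun t => (e1 t).deriv
  have e3 : timeDeriv (timeDeriv fun τ => Φ (Real.exp τ)) τ x
      = deriv (deriv fun s => Φ s x) (Real.exp τ) * Real.exp τ * Real.exp τ
        + deriv (fun s => Φ s x) (Real.exp τ) * Real.exp τ := by
    have := ((hd2 _ (Real.exp_pos τ)).comp τ (Real.hasDerivAt_exp τ)).mul (Real.hasDerivAt_exp τ)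
    change deriv (fun s => timeDeriv (fun τ => Φ (Real.exp τ)) s x) τ = _
    rw [e2]
    exact this.deriv
  have e4 : timeDeriv (fun τ => Φ (Real.exp τ)) τ x
      = deriv (fun s => Φ s x) (Real.exp τ) * Real.exp τ := (e1 τ).deriv
  have h5 := h.equation _ (Real.exp_pos τ) x
  rw [laplacian_eq_lap (h.jointlySmooth_exp.space τ)] at h5
  -- The extra `1` is cancelled by the first-order term that the substitution `η = e^τ` produces in
  -- the second derivative.
  have h6 : 6 * (1 + w) / (1 + 3 * w) = 2 * nu w + 1 := by
    have : 1 + 3 * w ≠ 0 := by linarith [hw.1]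
    have hq := div_mul_cancel₀ (5 + 3 * w) this
    rw [div_eq_iff this, nu]
    linear_combination -hq
  rw [h6] at h5
  have h7 : (Real.exp τ)⁻¹ * Real.exp τ = 1 := inv_mul_cancel₀ (Real.exp_ne_zero τ)
  have h8 : Real.exp (2 * τ) = Real.exp τ * Real.exp τ := by rw [← Real.exp_add]; ring_nf
  rw [e3, e4, h8]
  linear_combination (Real.exp τ * Real.exp τ) * h5
    - (2 * nu w + 1) * deriv (fun s => Φ s x) (Real.exp τ) * Real.exp τ * h7

theorem theorem1 (w : ℝ) (hw : w ∈ Set.Icc (0 : ℝ) 1) :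
    -- The operators expressing the coefficients through the data depend on `w` only.
    ∃ P Q : ℝ → Fin 2 → (List (Fin 3) →₀ ℝ),
      ∀ (L : Submodule ℤ E3) [DiscreteTopology L] [IsZLattice ℝ L] (Φ : ℝ → E3 → ℝ),
        IsSmoothSolution w L Φ →
        ∃ (κ : ℕ → ℝ) (c : ℝ → Fin 2 → E3 → ℝ),
          -- the exponents
          StrictMono κ ∧ Filter.Tendsto κ Filter.atTop Filter.atTop ∧
          (∀ n, -2 * nu w ≤ κ n) ∧ (∀ k l, k ∉ Set.range κ → c k l = 0) ∧
          -- the coefficients are smooth functions on the torus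
          (∀ k l, ContDiff ℝ ∞ (c k l) ∧ LatticePeriodic L (c k l)) ∧
          -- the expansion
          IsAsymptoticTo κ c Φ ∧
          -- all coefficients are expressed through two of them
          (∀ k l x, c k l x
            = constCoeffOp (P k l) (c (-2 * nu w) 0) x + constCoeffOp (Q k l) (c 0 0) x) ∧
          -- vanishing of coefficients
          ((∀ n : ℤ, nu w ≠ n) → ∀ k, c k 1 = 0) ∧
          (∀ k, k < 0 → c k 1 = 0) ∧
          (∀ k, c k 0 ≠ 0 → ∃ i : ℕ, k = -2 * nu w + 2 * i ∨ k = 2 * i) ∧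
          (∀ k, c k 1 ≠ 0 → ∃ i : ℕ, k = 2 * i) ∧
          -- the recursion relations
          (∀ k x, k * (k + 2 * nu w) * c k 0 x
            = w * Δ (c (k - 2) 0) x - (2 * k + 2 * nu w) * c k 1 x) ∧
          (∀ k x, k * (k + 2 * nu w) * c k 1 x = w * Δ (c (k - 2) 1) x) := by
  obtain ⟨hν1, hν2⟩ := nu_bounds hw
  have hν : 0 < nu w := by linarith
  -- The operators are fixed before the lattice and the solution, as they involve only the scalars
  -- of the formal solutions.
  refine ⟨fun k l => evenExt (fun j => singularScalar (nu w) w l j • lapWord j) (k + 2 * nu w),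
    fun k l => evenExt (fun j => regularScalar (nu w) w l j • lapWord j) k, fun L _ _ Φ hΦ => ?_⟩
  obtain ⟨A, B, hA, hB, hexp⟩ := exists_expansion hν1 hν2 hw.1 hΦ.jointlySmooth_exp
    (fun τ => hΦ.periodic _ (Real.exp_pos τ)) (hΦ.solvesWave hw)
  obtain ⟨κ, hκ, hκt, hκν, h1, h2⟩ := exists_exponents hν
  refine ⟨κ, coef (nu w) w A B, hκ, hκt, hκν, fun k l hk => ?_, coef_torusSmooth hA hB,
    isAsymptoticTo_of_decay
      (decay_sub_partialSum hΦ.jointlySmooth_exp hA hB hexp hν hκ h1 h2), fun k l x => ?_,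
    fun hn k => ?_, fun k hk => ?_, fun k => exists_of_coef_ne_zero, fun k hk => ?_,
    coef_recursion_zero hν hA.1 hB.1, coef_recursion_one hA.1 hB.1⟩
  · by_contra hne
    obtain ⟨i, hi | hi⟩ := exists_of_coef_ne_zero hne
    · obtain ⟨n, hn⟩ := h1 i
      exact hk ⟨n, hn.trans hi.symm⟩
    · obtain ⟨n, hn⟩ := h2 i
      exact hk ⟨n, by rw [hn, hi, zero_add]⟩
  · rw [coef_singular hν, coef_regular hν, ← constCoeffOp_evenExt hB.1,
      ← constCoeffOp_evenExt hA.1]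
    rfl
  · by_contra hne
    obtain ⟨n, _, h, _⟩ := exists_of_coef_one_ne_zero hne
    exact hn n (by exact_mod_cast h)
  · by_contra hne
    obtain ⟨_, i, _, h⟩ := exists_of_coef_one_ne_zero hne
    have : (0 : ℝ) ≤ i := Nat.cast_nonneg i
    linarith
  · obtain ⟨_, i, _, h⟩ := exists_of_coef_one_ne_zero hk
    exact ⟨i, h⟩

end Main
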